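/- **Setting.** Let $Y_1,Y_2,\dots$ be i.i.d. random variables with law $Q$ on a measurable space $\mathcal Y$ and let $\Theta\subset\mathbb R^p$. Let $(g^\theta)$ be a family of real functions on $\mathcal Y$ indexed by the parameter $\theta$ (for instance probability densities), $\phi(\theta,y)$ a real estimating loss and $\psi(g^\theta,y)$ a real assessment loss. Put $$\Phi_n(\theta)=\frac1n\sum_{i=1}^n\phi(\theta,Y_i),\qquad \Phi_{n|i}(\theta)=\frac1{n-1}\sum_{j\neq i}\phi(\theta,Y_j),\qquad \Phi_\infty(\theta)=\mathrm E\,\phi(\theta,Y_1).$$ **Conditions.** 1. For $\theta\in\Theta$ the function $\phi(\theta,\cdot)$ is measurable. For every $y$, $\phi(\cdot,y)$ is continuous on $\Theta$ and three times differentiable on the interior $\Theta^\circ$, and $\theta\mapsto\psi(g^\theta,y)$ is twice differentiable on $\Theta^\circ$. 2. Each $\theta\in\Theta$ has a neighbourhood $V$ and a $Q$-integrable function $h$ such that, for $Q$-almost every $y$, $\phi(t,y)\ge h(y)$ for all $t\in V\cap\Theta$. Thus $\Phi_\infty(\theta)\in(-\infty,+\infty]$. There is $\theta_0\in\Theta^\circ$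 with $\Phi_\infty(\theta_0)<\infty$ and $\Phi_\infty(\theta_0)<\Phi_\infty(\theta)$ for all $\theta\in\Theta\setminus\{\theta_0\}$. 3. There are $r>0$ and measurable functions $B_1,B_2,B_3,C_1,C_2$ on $\mathcal Y$ such that, for $Q$-almost every $y$ and all $\theta\in\Theta^\circ$ with $\|\theta-\theta_0\|<r$, the $k$-th derivative in $\theta$ of $\phi(\theta,y)$ has norm at most $B_k(y)$ for $k=1,2,3$, and that of $\psi(g^\theta,y)$ has norm at most $C_k(y)$ for $k=1,2$. The functions $B_2$, $B_3$, $C_1B_1(1+B_1+B_2)$ and $C_2B_1^2$ are $Q$-integrable. 4. The matrix $\mathrm E\{\partial^2\phi(\theta,Y_1)/\partial\theta\,\partial\theta^T|_{\theta_0}\}$ is nonsingular. 5. $\hat\theta=\hat\theta_n$ and $\hat\theta_{-i}=\hat\theta_{n,-i}$ $(1\le i\le n)$ are random points of $\mathbb R^p$ (measurability is not required) and $K_0\subset\Theta$ is a compact set such that, with probability tending to one as $n\to\infty$: $\hat\theta$ minimises $\Phi_n$ over $\Theta$, for every $i\le n$ the point $\hat\theta_{-i}$ minimises $\Phi_{n|i}$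 over $\Theta$, and all these points lie in $K_0$. **Notation.** Let $H=\partial^2\Phi_n/\partial\theta\,\partial\theta^T|_{\hat\theta}$ and $$\hat d_i=\frac1{n-1}\left.\frac{\partial\phi(\theta,Y_i)}{\partial\theta}\right|_{\hat\theta},\qquad \hat v_i=\left.\frac{\partial\psi(g^\theta,Y_i)}{\partial\theta}\right|_{\hat\theta},\qquad K=\frac1n\sum_{i=1}^n\hat v_i\hat d_i^T,$$ $$\mathrm{CV}(g^{\hat\theta})=\frac1n\sum_{i=1}^n\psi(g^{\hat\theta_{-i}},Y_i),\qquad \mathrm{UACV}(g^{\hat\theta})=\frac1n\sum_{i=1}^n\psi(g^{\hat\theta},Y_i)+\mathrm{Trace}(H^{-1}K).$$ $X_n=O_p(r_n)$ means that for every $\varepsilon>0$ there is $M$ with $P(\|X_n\|>Mr_n)\le\varepsilon$ for all large $n$ (outer probability, if $X_n$ is not measurable). **Theorem.** Under conditions 1–5, as $n\to\infty$: (a) with probability tending to one, $\hat\theta\in\Theta^\circ$ and $H$ is nonsingular; (b) $\hat\theta_{-i}-\hat\theta=H^{-1}\hat d_i+O_p(n^{-2})$, for every choice of indices $i=i_n\le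 n$; (c) $\mathrm{CV}(g^{\hat\theta})=\mathrm{UACV}(g^{\hat\theta})+O_p(n^{-2})$; (d) suppose that, for all $\theta\in\Theta$ and all $y$, $g^\theta(y)>0$ and $\phi(\theta,y)=\psi(g^\theta,y)=-\log g^\theta(y)$. Let $J=-\frac1n\sum_i\partial^2\log g^\theta(Y_i)/\partial\theta\,\partial\theta^T|_{\hat\theta}$, let $I=\frac1n\sum_i\hat s_i\hat s_i^T$ with $\hat s_i=\partial\log g^\theta(Y_i)/\partial\theta|_{\hat\theta}$, and let $\mathrm{TIC}=-2\sum_i\log g^{\hat\theta}(Y_i)+2\,\mathrm{Trace}(J^{-1}I)$ be Takeuchi's information criterion. Then, for all $n\ge2$, whenever $\hat\theta\in\Theta^\circ$, $$\mathrm{UACV}(g^{\hat\theta})=\frac1{2n}\mathrm{TIC}+\frac1{n(n-1)}\mathrm{Trace}(J^{-1}I)$$ (with $J^{-1}$ read as $0$ if $J$ is singular), and $\mathrm{UACV}(g^{\hat\theta})=\frac1{2n}\mathrm{TIC}+O_p(n^{-2})$. -/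

import Mathlib

open MeasureTheory ProbabilityTheory Filter Topology

noncomputable section

namespace CrossVal

/-- The parameter space `ℝᵖ` with its Euclidean norm. -/
abbrev Param (p : ℕ) := EuclideanSpace ℝ (Fin p)

/-- `X n = O_p(r n)` as `n → ∞`: for every `ε > 0` there is a constant `M` such that
`P(‖X n‖ > M * r n) ≤ ε` for all large `n`.  (If `X n` is not measurable, `P` is the outer
probability.) -/
def IsBigOp {Ω F : Type*} [MeasurableSpace Ω] [Norm F] (P : Measure Ω)
    (X : ℕ → Ω → F) (r : ℕ → ℝ) : Prop :=
  ∀ ε : ℝ, 0 < ε → ∃ M : ℝ, ∃ N : ℕ, ∀ n : ℕ, N ≤ n →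
    P {ω | M * r n < ‖X n ω‖} ≤ ENNReal.ofReal ε

/-- `f` is `m` times differentiable (in the sense of Fréchet) at every point of the open set `s`. -/
def DiffTimesOn {p : ℕ} (m : ℕ) (f : Param p → ℝ) (s : Set (Param p)) : Prop :=
  ∀ k : ℕ, k < m → ∀ θ ∈ s, DifferentiableAt ℝ (iteratedFDeriv ℝ k f) θ

/-- The Hessian matrix `∂²f / ∂θ_a ∂θ_b` at `θ`. -/
def hessMatrix {p : ℕ} (f : Param p → ℝ) (θ : Param p) : Matrix (Fin p) (Fin p) ℝ :=
  Matrix.of fun a b =>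
    iteratedFDeriv ℝ 2 f θ ![EuclideanSpace.single a 1, EuclideanSpace.single b 1]

/-- The outer product `u vᵀ`. -/
def outer {p : ℕ} (u v : Param p) : Matrix (Fin p) (Fin p) ℝ :=
  Matrix.of fun a b => u a * v b

section Criteria

variable {p : ℕ} {𝓨 : Type*}

/-- The estimating function `Φ_n(θ) = n⁻¹ ∑ φ(θ, y_i)` of the sample `y_0, …, y_{n-1}`. -/
def empRisk (φ : Param p → 𝓨 → ℝ) (y : ℕ → 𝓨) (n : ℕ) (θ : Param p) : ℝ :=
  (n : ℝ)⁻¹ * ∑ i ∈ Finset.range n, φ θ (y i)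

/-- The leave-one-out estimating function
`Φ_{n|i}(θ) = (n-1)⁻¹ ∑_{j ≠ i} φ(θ, y_j)`. -/
def looRisk (φ : Param p → 𝓨 → ℝ) (y : ℕ → 𝓨) (n i : ℕ) (θ : Param p) : ℝ :=
  ((n : ℝ) - 1)⁻¹ * ∑ j ∈ (Finset.range n).erase i, φ θ (y j)

/-- `θ` is a minimiser of `f` over `Θ`. -/
def IsArgmin (f : Param p → ℝ) (Θ : Set (Param p)) (θ : Param p) : Prop :=
  θ ∈ Θ ∧ ∀ t ∈ Θ, f θ ≤ f t

/-- The leave-one-out crossvalidation criterion `n⁻¹ ∑ ψ(g^{θ̂₋ᵢ}, y_i)`, where `θm i` is the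
estimator `θ̂₋ᵢ` computed without the `i`-th observation. -/
def cvCrit (g : Param p → 𝓨 → ℝ) (ψ : (𝓨 → ℝ) → 𝓨 → ℝ) (y : ℕ → 𝓨) (n : ℕ)
    (θm : ℕ → Param p) : ℝ :=
  (n : ℝ)⁻¹ * ∑ i ∈ Finset.range n, ψ (g (θm i)) (y i)

/-- `d̂_i = (n-1)⁻¹ ∂φ(θ, y_i)/∂θ` at `θ`. -/
def dHat (φ : Param p → 𝓨 → ℝ) (y : ℕ → 𝓨) (n i : ℕ) (θ : Param p) : Param p :=
  ((n : ℝ) - 1)⁻¹ • gradient (fun t => φ t (y i)) θ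

/-- `v̂_i = ∂ψ(g^θ, y_i)/∂θ` at `θ`. -/
def vHat (g : Param p → 𝓨 → ℝ) (ψ : (𝓨 → ℝ) → 𝓨 → ℝ) (y : ℕ → 𝓨) (i : ℕ)
    (θ : Param p) : Param p :=
  gradient (fun t => ψ (g t) (y i)) θ

/-- `K = n⁻¹ ∑ v̂_i d̂_iᵀ`. -/
def kMatrix (φ : Param p → 𝓨 → ℝ) (g : Param p → 𝓨 → ℝ) (ψ : (𝓨 → ℝ) → 𝓨 → ℝ)
    (y : ℕ → 𝓨) (n : ℕ) (θ : Param p) : Matrix (Fin p) (Fin p) ℝ :=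
  (n : ℝ)⁻¹ • ∑ i ∈ Finset.range n, outer (vHat g ψ y i θ) (dHat φ y n i θ)

/-- The universal approximate crossvalidation criterion
`n⁻¹ ∑ ψ(g^θ, y_i) + Trace(H⁻¹ K)`, with `H` the Hessian of `Φ_n`, everything evaluated at `θ`. -/
def uacv (φ : Param p → 𝓨 → ℝ) (g : Param p → 𝓨 → ℝ) (ψ : (𝓨 → ℝ) → 𝓨 → ℝ)
    (y : ℕ → 𝓨) (n : ℕ) (θ : Param p) : ℝ :=
  (n : ℝ)⁻¹ * ∑ i ∈ Finset.range n, ψ (g θ) (y i) +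
    Matrix.trace ((hessMatrix (empRisk φ y n) θ)⁻¹ * kMatrix φ g ψ y n θ)

/-- The normalised observed information `J = - n⁻¹ ∑ ∂² log g^θ(y_i)/∂θ²`. -/
def obsInfo (g : Param p → 𝓨 → ℝ) (y : ℕ → 𝓨) (n : ℕ) (θ : Param p) :
    Matrix (Fin p) (Fin p) ℝ :=
  -hessMatrix (fun t => (n : ℝ)⁻¹ * ∑ i ∈ Finset.range n, Real.log (g t (y i))) θ

/-- The normalised sum `I = n⁻¹ ∑ s_i s_iᵀ` of outer products of the individual scores
`s_i = ∂ log g^θ(y_i)/∂θ`. -/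
def scoreCov (g : Param p → 𝓨 → ℝ) (y : ℕ → 𝓨) (n : ℕ) (θ : Param p) :
    Matrix (Fin p) (Fin p) ℝ :=
  (n : ℝ)⁻¹ • ∑ i ∈ Finset.range n,
    outer (gradient (fun t => Real.log (g t (y i))) θ)
      (gradient (fun t => Real.log (g t (y i))) θ)

/-- Takeuchi's information criterion `TIC = -2 ∑ log g^θ(y_i) + 2 Trace(J⁻¹ I)`. -/
def tic (g : Param p → 𝓨 → ℝ) (y : ℕ → 𝓨) (n : ℕ) (θ : Param p) : ℝ :=
  -2 * ∑ i ∈ Finset.range n, Real.log (g θ (y i)) +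
    2 * Matrix.trace ((obsInfo g y n θ)⁻¹ * scoreCov g y n θ)

end Criteria

end CrossVal

end

/-! Deleting one observation perturbs the estimating equation by a term of relative size 1/n, and
the minimiser answers by one Newton step, up to second order. By Wald's argument
(`whp_not_isArgmin`) the full and all leave-one-out minimisers lie, with probability tending to one,
in a small ball inside the interior, so they are critical points. The law of large numbers at θ₀ and
the Lipschitz constant B₃ of the second derivatives keep H near its nonsingular limit, so H⁻¹ stays
bounded (`exists_bound_inv`).

Put Δ = θ̂₋ᵢ - θ̂. Comparing the two critical-point equations gives (n-1)(HΔ - d̂ᵢ) = -HΔ + Tᵢ - R,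
where Tᵢ is the Hessian of the i-th loss applied to Δ and ‖R‖ ≤ bn‖Δ‖². Since Δ is small and max
B₂(Yᵢ) = o(n), the right side can be absorbed: first ‖Δ‖ = O(B₁/n), and then, substituting this
back, Δ - H⁻¹d̂ᵢ = O(B₁(1+B₁+B₂)/n²) (`displacement_bounds`). `exists_whp_expansion` gives this on
one event for all i at once.

Part (b) follows because B₁(1+B₁+B₂) at one observation is tight. For (c), expand ψ at θ̂: the
linear terms average exactly to Trace(H⁻¹K) (`cvCrit_sub_uacv`), and the errors average to n⁻² times
a sample mean of C₂B₁² + C₁B₁(1+B₁+B₂), which is bounded in probability. Part (d) is algebra, H = J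
and K = I/(n-1), together with a bound for the trace. -/

namespace CrossVal

set_option maxSynthPendingDepth 3

/-! ### Derivatives, Hessian matrices, Taylor bounds and perturbation of inverses -/

section Calculus

variable {p : ℕ} {f : Param p → ℝ} {s : Set (Param p)} {θ : Param p}

/-- Currying is a linear isometry, so differentiability passes through it. This turns `DiffTimesOn`
into statements about nested `fderiv`, to which the mean value inequality applies. -/
lemma differentiableAt_iteratedFDeriv_fderiv {E F : Type*} [NormedAddCommGroup E]
    [NormedSpace ℝ E] [NormedAddCommGroup F] [NormedSpace ℝ F] {f : E → F} {k : ℕ} {x : E}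
    (h : DifferentiableAt ℝ (iteratedFDeriv ℝ (k + 1) f) x) :
    DifferentiableAt ℝ (iteratedFDeriv ℝ k (fderiv ℝ f)) x := by
  rw [show iteratedFDeriv ℝ (k + 1) f = _ from
    funext fun x => iteratedFDeriv_succ_eq_comp_right] at h
  exact (LinearIsometryEquiv.comp_differentiableAt_iff _).1 h

lemma differentiableAt_of_iteratedFDeriv_zero {E F : Type*} [NormedAddCommGroup E]
    [NormedSpace ℝ E] [NormedAddCommGroup F] [NormedSpace ℝ F] {f : E → F} {x : E}
    (h : DifferentiableAt ℝ (iteratedFDeriv ℝ 0 f) x) : DifferentiableAt ℝ f x := by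
  rw [iteratedFDeriv_zero_eq_comp] at h
  exact (LinearIsometryEquiv.comp_differentiableAt_iff _).1 h

lemma DiffTimesOn.differentiableAt {m : ℕ} (hf : DiffTimesOn (m + 1) f s) (hθ : θ ∈ s) :
    DifferentiableAt ℝ f θ :=
  differentiableAt_of_iteratedFDeriv_zero (hf 0 (by omega) θ hθ)

lemma DiffTimesOn.differentiableAt_fderiv {m : ℕ} (hf : DiffTimesOn (m + 2) f s) (hθ : θ ∈ s) :
    DifferentiableAt ℝ (fderiv ℝ f) θ :=
  differentiableAt_of_iteratedFDeriv_zero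
    (differentiableAt_iteratedFDeriv_fderiv (hf 1 (by omega) θ hθ))

lemma DiffTimesOn.differentiableAt_fderiv_fderiv {m : ℕ} (hf : DiffTimesOn (m + 3) f s)
    (hθ : θ ∈ s) : DifferentiableAt ℝ (fderiv ℝ (fderiv ℝ f)) θ :=
  differentiableAt_of_iteratedFDeriv_zero (differentiableAt_iteratedFDeriv_fderiv
    (differentiableAt_iteratedFDeriv_fderiv (hf 2 (by omega) θ hθ)))

/-- Differentiability of the m-th derivative makes it continuous. Three derivatives thus give C²,
hence symmetric Hessians, with no continuity of the third derivative. -/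
lemma DiffTimesOn.contDiffAt {m : ℕ} (hf : DiffTimesOn (m + 1) f s) (hs : IsOpen s)
    (hθ : θ ∈ s) : ContDiffAt ℝ m f θ := by
  have : ContDiffOn ℝ ((m : ℕ∞) : WithTop ℕ∞) f s := by
    refine contDiffOn_of_differentiableOn fun k hk => ?_
    have hk' : k ≤ m := by exact_mod_cast hk
    refine DifferentiableOn.congr (f := iteratedFDeriv ℝ k f)
      (fun x hx => (hf k (by omega) x hx).differentiableWithinAt) fun x hx => ?_
    exact iteratedFDerivWithin_of_isOpen k hs hx
  exact this.contDiffAt (hs.mem_nhds hθ)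

lemma norm_fderiv_fderiv {E F : Type*} [NormedAddCommGroup E] [NormedSpace ℝ E]
    [NormedAddCommGroup F] [NormedSpace ℝ F] (f : E → F) (x : E) :
    ‖fderiv ℝ (fderiv ℝ f) x‖ = ‖iteratedFDeriv ℝ 2 f x‖ := by
  rw [← norm_iteratedFDeriv_fderiv, norm_iteratedFDeriv_one]

lemma norm_fderiv_fderiv_fderiv {E F : Type*} [NormedAddCommGroup E] [NormedSpace ℝ E]
    [NormedAddCommGroup F] [NormedSpace ℝ F] (f : E → F) (x : E) :
    ‖fderiv ℝ (fderiv ℝ (fderiv ℝ f)) x‖ = ‖iteratedFDeriv ℝ 3 f x‖ := by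
  rw [norm_fderiv_fderiv, norm_iteratedFDeriv_fderiv]

lemma norm_gradient_eq (f : Param p → ℝ) (θ : Param p) :
    ‖gradient f θ‖ = ‖iteratedFDeriv ℝ 1 f θ‖ := by
  rw [norm_iteratedFDeriv_one, gradient, LinearIsometryEquiv.norm_map]

lemma hessMatrix_apply (f : Param p → ℝ) (θ : Param p) (a b : Fin p) :
    hessMatrix f θ a b =
      fderiv ℝ (fderiv ℝ f) θ (EuclideanSpace.single a 1) (EuclideanSpace.single b 1) := by
  simp [hessMatrix, iteratedFDeriv_two_apply]

lemma abs_hessMatrix_le (f : Param p → ℝ) (θ : Param p) (a b : Fin p) :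
    |hessMatrix f θ a b| ≤ ‖iteratedFDeriv ℝ 2 f θ‖ := by
  rw [hessMatrix_apply, ← norm_fderiv_fderiv, ← Real.norm_eq_abs]
  refine (ContinuousLinearMap.le_opNorm₂ _ _ _).trans ?_
  simp

lemma hessMatrix_comm (hf : ContDiffAt ℝ 2 f θ) (a b : Fin p) :
    hessMatrix f θ a b = hessMatrix f θ b a := by
  rw [hessMatrix_apply, hessMatrix_apply]
  exact (hf.isSymmSndFDerivAt (by simp)).eq _ _

/-- Through this identity the Taylor formula for `fderiv ℝ f` becomes one for the gradient. Symmetry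
is needed because the two sides feed `v` into different slots of the second derivative. -/
lemma toEuclideanLin_hessMatrix (hf : ContDiffAt ℝ 2 f θ) (v : Param p) :
    Matrix.toEuclideanLin (hessMatrix f θ) v =
      (InnerProductSpace.toDual ℝ (Param p)).symm (fderiv ℝ (fderiv ℝ f) θ v) := by
  ext a
  have h1 : (Matrix.toEuclideanLin (hessMatrix f θ) v) a = ∑ b, hessMatrix f θ a b * v b := by
    simp [Matrix.toLpLin_apply, Matrix.mulVec, dotProduct]
  have h2 : v = ∑ b, v b • EuclideanSpace.single b (1 : ℝ) := by
    ext c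
    simp [Finset.sum_apply, Pi.single_apply]
  have h3 : ∀ w : Param p, w a = inner ℝ w (EuclideanSpace.single a (1 : ℝ)) := by
    intro w
    simp [EuclideanSpace.inner_single_right]
  rw [h1, h3, InnerProductSpace.toDual_symm_apply]
  conv_rhs => rw [h2]
  simp only [map_sum, map_smul, _root_.sum_apply, _root_.smul_apply,
    smul_eq_mul]
  refine Finset.sum_congr rfl fun b _ => ?_
  rw [hessMatrix_comm hf, hessMatrix_apply, mul_comm]

/-- First-order Taylor formula with a quadratic bound for the remainder. -/
lemma norm_taylor_one_le {E F : Type*} [NormedAddCommGroup E] [NormedSpace ℝ E]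
    [NormedAddCommGroup F] [NormedSpace ℝ F] {f : E → F} {s : Set E} {C : ℝ} {x y : E}
    (hs : Convex ℝ s) (hf : ∀ z ∈ s, DifferentiableAt ℝ f z)
    (hf' : ∀ z ∈ s, DifferentiableAt ℝ (fderiv ℝ f) z)
    (hC : ∀ z ∈ s, ‖fderiv ℝ (fderiv ℝ f) z‖ ≤ C) (hx : x ∈ s) (hy : y ∈ s) :
    ‖f y - f x - fderiv ℝ f x (y - x)‖ ≤ C * ‖y - x‖ ^ 2 := by
  have hC0 : 0 ≤ C := (norm_nonneg _).trans (hC x hx)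
  have hseg : segment ℝ x y ⊆ s := hs.segment_subset hx hy
  -- Mean value inequality for `f` minus its linear part at `x`. It yields `C` instead of the sharp
  -- `C / 2`, which costs only constants.
  have := (convex_segment x y).norm_image_sub_le_of_norm_fderiv_le' (𝕜 := ℝ) (f := f)
    (φ := fderiv ℝ f x) (C := C * ‖y - x‖) (fun z hz => hf z (hseg hz))
    (fun z hz => ?_) (left_mem_segment ℝ x y) (right_mem_segment ℝ x y)
  · linarith [this, pow_two ‖y - x‖, mul_assoc C ‖y - x‖ ‖y - x‖]
  · refine (hs.norm_image_sub_le_of_norm_fderiv_le hf' hC hx (hseg hz)).trans ?_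
    gcongr
    obtain ⟨a, b, ha, hb, hab, rfl⟩ := hz
    have : a • x + b • y - x = b • (y - x) := by
      have : a = 1 - b := by linarith
      rw [this]; module
    rw [this, norm_smul, Real.norm_eq_abs, abs_of_nonneg hb]
    nlinarith [norm_nonneg (y - x)]

lemma DiffTimesOn.mono {m : ℕ} {t : Set (Param p)} (hf : DiffTimesOn m f s) (h : t ⊆ s) :
    DiffTimesOn m f t := fun k hk θ hθ => hf k hk θ (h hθ)

lemma DiffTimesOn.abs_taylor_le {C : ℝ} {x y : Param p} (hf : DiffTimesOn 2 f s)
    (hs : Convex ℝ s) (hC : ∀ z ∈ s, ‖iteratedFDeriv ℝ 2 f z‖ ≤ C) (hx : x ∈ s) (hy : y ∈ s) :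
    |f y - f x - inner ℝ (gradient f x) (y - x)| ≤ C * ‖y - x‖ ^ 2 := by
  rw [gradient, InnerProductSpace.toDual_symm_apply]
  exact norm_taylor_one_le hs (fun z hz => hf.differentiableAt hz)
    (fun z hz => hf.differentiableAt_fderiv hz)
    (fun z hz => (norm_fderiv_fderiv f z).trans_le (hC z hz)) hx hy

lemma DiffTimesOn.norm_gradient_taylor_le {C : ℝ} {x y : Param p} (hf : DiffTimesOn 3 f s)
    (hso : IsOpen s) (hs : Convex ℝ s) (hC : ∀ z ∈ s, ‖iteratedFDeriv ℝ 3 f z‖ ≤ C)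
    (hx : x ∈ s) (hy : y ∈ s) :
    ‖gradient f y - gradient f x - Matrix.toEuclideanLin (hessMatrix f x) (y - x)‖
      ≤ C * ‖y - x‖ ^ 2 := by
  rw [toEuclideanLin_hessMatrix (hf.contDiffAt hso hx), gradient, gradient, ← map_sub, ← map_sub,
    LinearIsometryEquiv.norm_map]
  exact norm_taylor_one_le hs (fun z hz => hf.differentiableAt_fderiv hz)
    (fun z hz => hf.differentiableAt_fderiv_fderiv hz)
    (fun z hz => (norm_fderiv_fderiv_fderiv f z).trans_le (hC z hz)) hx hy

lemma DiffTimesOn.abs_hessMatrix_sub_le {C : ℝ} {x y : Param p} (hf : DiffTimesOn 3 f s)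
    (hs : Convex ℝ s) (hC : ∀ z ∈ s, ‖iteratedFDeriv ℝ 3 f z‖ ≤ C)
    (hx : x ∈ s) (hy : y ∈ s) (a b : Fin p) :
    |hessMatrix f y a b - hessMatrix f x a b| ≤ C * ‖y - x‖ := by
  rw [hessMatrix_apply, hessMatrix_apply, ← _root_.sub_apply,
    ← _root_.sub_apply, ← Real.norm_eq_abs]
  refine (ContinuousLinearMap.le_opNorm₂ _ _ _).trans ?_
  simpa using hs.norm_image_sub_le_of_norm_fderiv_le (𝕜 := ℝ)
    (fun z hz => hf.differentiableAt_fderiv_fderiv hz)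
    (fun z hz => (norm_fderiv_fderiv_fderiv f z).trans_le (hC z hz)) hx hy

lemma norm_toEuclideanLin_hessMatrix_le (hf : ContDiffAt ℝ 2 f θ) (v : Param p) :
    ‖Matrix.toEuclideanLin (hessMatrix f θ) v‖ ≤ ‖iteratedFDeriv ℝ 2 f θ‖ * ‖v‖ := by
  rw [toEuclideanLin_hessMatrix hf, LinearIsometryEquiv.norm_map, ← norm_fderiv_fderiv]
  exact ContinuousLinearMap.le_opNorm _ _

lemma hessMatrix_const_mul_sum {ι : Type*} (u : Finset ι) (c : ℝ) (f : ι → Param p → ℝ)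
    (hf : ∀ i ∈ u, ContDiffAt ℝ 2 (f i) θ) :
    hessMatrix (fun t => c * ∑ i ∈ u, f i t) θ = c • ∑ i ∈ u, hessMatrix (f i) θ := by
  ext a b
  have h1 : iteratedFDeriv ℝ 2 (fun t => c * ∑ i ∈ u, f i t) θ =
      c • ∑ i ∈ u, iteratedFDeriv ℝ 2 (f i) θ := by
    have h2 : ContDiffAt ℝ 2 (fun t => ∑ i ∈ u, f i t) θ := ContDiffAt.sum hf
    have := iteratedFDeriv_const_smul_apply (𝕜 := ℝ) (a := c) h2
    rw [show (fun t => c * ∑ i ∈ u, f i t) = c • fun t => ∑ i ∈ u, f i t from rfl, this]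
    rw [iteratedFDeriv_fun_sum_apply hf]
  simp [hessMatrix, h1, Matrix.sum_apply]

lemma gradient_const_mul_sum {ι : Type*} (u : Finset ι) (c : ℝ) (f : ι → Param p → ℝ)
    (hf : ∀ i ∈ u, DifferentiableAt ℝ (f i) θ) :
    gradient (fun t => c * ∑ i ∈ u, f i t) θ = c • ∑ i ∈ u, gradient (f i) θ := by
  have h : DifferentiableAt ℝ (fun t => ∑ i ∈ u, f i t) θ := DifferentiableAt.fun_sum hf
  simp only [gradient]
  rw [fderiv_const_mul h, fderiv_fun_sum hf]
  simp

/-- A minimiser in the interior is a critical point. -/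
lemma IsArgmin.gradient_eq_zero {Θ : Set (Param p)} (h : IsArgmin f Θ θ)
    (hθ : θ ∈ interior Θ) : gradient f θ = 0 := by
  have : IsLocalMin f θ := by
    filter_upwards [isOpen_interior.mem_nhds hθ] with t ht using h.2 t (interior_subset ht)
  rw [gradient, this.fderiv_eq_zero, map_zero]

lemma trace_mul_outer (M : Matrix (Fin p) (Fin p) ℝ) (u v : Param p) :
    Matrix.trace (M * outer u v) = inner ℝ v (Matrix.toEuclideanLin M u) := by
  simp only [Matrix.trace, Matrix.diag, Matrix.mul_apply, outer, Matrix.of_apply,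
    PiLp.inner_apply, Matrix.toLpLin_apply, Matrix.mulVec, dotProduct,
    Finset.sum_mul, RCLike.inner_apply, conj_trivial]
  refine Finset.sum_congr rfl fun a _ => Finset.sum_congr rfl fun b _ => ?_
  ring

lemma outer_smul (c : ℝ) (u v : Param p) : outer u (c • v) = c • outer u v := by
  ext a b
  simp [outer]
  ring

/-- A symmetric matrix acts as a symmetric operator. -/
lemma inner_toEuclideanLin_comm {M : Matrix (Fin p) (Fin p) ℝ} (hM : M.transpose = M)
    (u v : Param p) :
    inner ℝ u (Matrix.toEuclideanLin M v) = inner ℝ v (Matrix.toEuclideanLin M u) := by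
  rw [← trace_mul_outer, ← trace_mul_outer, ← Matrix.trace_transpose, Matrix.transpose_mul, hM,
    Matrix.trace_mul_comm]
  congr 2
  ext a b
  simp [outer, mul_comm]

lemma toEuclideanLin_inv_apply_self {M : Matrix (Fin p) (Fin p) ℝ} (hM : M.det ≠ 0)
    (v : Param p) : Matrix.toEuclideanLin M⁻¹ (Matrix.toEuclideanLin M v) = v := by
  rw [Matrix.toLpLin_apply, Matrix.toLpLin_apply]
  simp [Matrix.mulVec_mulVec, Matrix.nonsing_inv_mul M (isUnit_iff_ne_zero.2 hM)]

lemma norm_toEuclideanLin_le (M : Matrix (Fin p) (Fin p) ℝ) (v : Param p) {c : ℝ}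
    (hc : ∀ a b, |M a b| ≤ c) : ‖Matrix.toEuclideanLin M v‖ ≤ p * p * c * ‖v‖ := by
  have key : ∀ a, |(Matrix.toEuclideanLin M v) a| ≤ p * c * ‖v‖ := by
    intro a
    have : (Matrix.toEuclideanLin M v) a = ∑ b, M a b * v b := by
      simp [Matrix.toLpLin_apply, Matrix.mulVec, dotProduct]
    rw [this]
    calc |∑ b, M a b * v b| ≤ ∑ b, |M a b * v b| := Finset.abs_sum_le_sum_abs _ _
      _ ≤ ∑ _b : Fin p, c * ‖v‖ := by
        refine Finset.sum_le_sum fun b _ => ?_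
        rw [abs_mul]
        have h1 : |v b| ≤ ‖v‖ := PiLp.norm_apply_le v b
        have := (abs_nonneg _).trans (hc a b)
        exact mul_le_mul (hc a b) h1 (abs_nonneg _) this
      _ = p * c * ‖v‖ := by simp; ring
  set w := Matrix.toEuclideanLin M v
  have hw : w = ∑ b, w b • EuclideanSpace.single b (1 : ℝ) := by
    ext c
    simp [Finset.sum_apply, Pi.single_apply]
  rw [hw]
  calc ‖∑ b, w b • EuclideanSpace.single b (1 : ℝ)‖
      ≤ ∑ b, ‖w b • EuclideanSpace.single b (1 : ℝ)‖ := norm_sum_le _ _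
    _ ≤ ∑ _b : Fin p, p * c * ‖v‖ := by
      refine Finset.sum_le_sum fun b _ => ?_
      rw [norm_smul]
      simpa using key b
    _ = p * p * c * ‖v‖ := by simp; ring

/-- Matrices close to a nonsingular matrix are nonsingular, with bounded inverses. -/
lemma exists_bound_inv {M₀ : Matrix (Fin p) (Fin p) ℝ} (h₀ : M₀.det ≠ 0) :
    ∃ ε > 0, ∃ c > 0, ∀ M : Matrix (Fin p) (Fin p) ℝ, (∀ a b, |M a b - M₀ a b| ≤ ε) →
      M.det ≠ 0 ∧ (∀ v, ‖Matrix.toEuclideanLin M v‖ ≤ c * ‖v‖) ∧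
        ∀ v, ‖Matrix.toEuclideanLin M⁻¹ v‖ ≤ c * ‖v‖ := by
  -- Continuity is read off from Cramer's formula: inverse determinant times adjugate.
  have hinv : ContinuousAt (fun M : Matrix (Fin p) (Fin p) ℝ => M⁻¹) M₀ := by
    have : (fun M : Matrix (Fin p) (Fin p) ℝ => M⁻¹) =
        fun M => Ring.inverse M.det • M.adjugate := by
      ext1 M; exact Matrix.inv_def M
    rw [this]
    have h2 : ContinuousAt (fun x : ℝ => Ring.inverse x) M₀.det := by
      simp only [Ring.inverse_eq_inv']
      exact continuousAt_inv₀ h₀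
    have h3 : ContinuousAt (fun M : Matrix (Fin p) (Fin p) ℝ => Ring.inverse M.det) M₀ :=
      ContinuousAt.comp (f := fun M : Matrix (Fin p) (Fin p) ℝ => M.det) h2
        (Continuous.matrix_det (A := fun M : Matrix (Fin p) (Fin p) ℝ => M)
          continuous_id).continuousAt
    exact h3.smul (Continuous.matrix_adjugate (A := fun M : Matrix (Fin p) (Fin p) ℝ => M)
      continuous_id).continuousAt
  have hdet : ∀ᶠ M : Matrix (Fin p) (Fin p) ℝ in 𝓝 M₀, M.det ≠ 0 :=
    (Continuous.matrix_det (A := fun M : Matrix (Fin p) (Fin p) ℝ => M)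
        continuous_id).continuousAt.eventually_ne h₀
  have hM : ∀ᶠ M : Matrix (Fin p) (Fin p) ℝ in 𝓝 M₀, ∀ a b, |M a b| < |M₀ a b| + 1 := by
    refine eventually_all.2 fun a => eventually_all.2 fun b => ?_
    exact (continuous_id.matrix_elem a b).abs.continuousAt.eventually_lt
      (continuousAt_const (y := |M₀ a b| + 1)) (by simp)
  have hMi : ∀ᶠ M : Matrix (Fin p) (Fin p) ℝ in 𝓝 M₀, ∀ a b, |M⁻¹ a b| < |M₀⁻¹ a b| + 1 := by
    refine eventually_all.2 fun a => eventually_all.2 fun b => ?_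
    exact (hinv.eventually ((continuous_id.matrix_elem a b).abs.continuousAt.eventually_lt
      (continuousAt_const (y := |M₀⁻¹ a b| + 1)) (by simp)))
  have hex : ∀ N : Matrix (Fin p) (Fin p) ℝ, ∃ c, 0 ≤ c ∧ ∀ a b, |N a b| + 1 ≤ c := by
    intro N
    refine ⟨∑ a, ∑ b, |N a b| + 1, by positivity, fun a b => ?_⟩
    have h1 : |N a b| ≤ ∑ b, |N a b| :=
      Finset.single_le_sum (f := fun b => |N a b|) (fun _ _ => abs_nonneg _) (Finset.mem_univ b)
    have h2 : ∑ b, |N a b| ≤ ∑ a, ∑ b, |N a b| :=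
      Finset.single_le_sum (f := fun a => ∑ b, |N a b|) (fun _ _ => by positivity)
        (Finset.mem_univ a)
    linarith
  obtain ⟨c₁, hc₁0, hc₁⟩ := hex M₀
  obtain ⟨c₂, hc₂0, hc₂⟩ := hex M₀⁻¹
  have hall := (hdet.and (hM.and hMi))
  have hbasis : ∃ ε > 0, ∀ M : Matrix (Fin p) (Fin p) ℝ, (∀ a b, |M a b - M₀ a b| ≤ ε) →
      M.det ≠ 0 ∧ (∀ a b, |M a b| < |M₀ a b| + 1) ∧ ∀ a b, |M⁻¹ a b| < |M₀⁻¹ a b| + 1 := by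
    -- As functions of two indices, matrices carry the sup metric, whose closed balls are exactly
    -- the entrywise conditions.
    have : ∀ᶠ M : Fin p → Fin p → ℝ in 𝓝 (fun a b => M₀ a b), (Matrix.of M).det ≠ 0 ∧
        (∀ a b, |(Matrix.of M) a b| < |M₀ a b| + 1) ∧
          ∀ a b, |(Matrix.of M)⁻¹ a b| < |M₀⁻¹ a b| + 1 := hall
    obtain ⟨ε, hε, h⟩ := Metric.nhds_basis_closedBall.eventually_iff.1 this
    refine ⟨ε, hε, fun M hM => h (x := fun a b => M a b) ?_⟩
    rw [Metric.mem_closedBall, dist_pi_le_iff hε.le]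
    intro a
    rw [dist_pi_le_iff hε.le]
    intro b
    rw [Real.dist_eq]
    exact hM a b
  obtain ⟨ε, hε, h⟩ := hbasis
  -- The summand 1 keeps the constant positive even when `p = 0`.
  refine ⟨ε, hε, p * p * c₁ + p * p * c₂ + 1, by positivity, fun M hM => ?_⟩
  obtain ⟨h1, h2, h3⟩ := h M hM
  refine ⟨h1, fun v => ?_, fun v => ?_⟩
  · refine (norm_toEuclideanLin_le M v fun a b => (h2 a b).le.trans (hc₁ a b)).trans ?_
    gcongr
    nlinarith [mul_nonneg (mul_nonneg (Nat.cast_nonneg (α := ℝ) p) (Nat.cast_nonneg p)) hc₂0]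
  · refine (norm_toEuclideanLin_le M⁻¹ v fun a b => (h3 a b).le.trans (hc₂ a b)).trans ?_
    gcongr
    nlinarith [mul_nonneg (mul_nonneg (Nat.cast_nonneg (α := ℝ) p) (Nat.cast_nonneg p)) hc₁0]

end Calculus

/-! ### Events of probability tending to one, laws of large numbers, stochastic order -/

section Probability

/-- The events `E n` hold with (inner) probability tending to one. -/
def WHP {Ω : Type*} [MeasurableSpace Ω] (P : Measure Ω) (E : ℕ → Ω → Prop) : Prop :=
  Tendsto (fun n => P {ω | ¬ E n ω}) atTop (𝓝 0)

variable {Ω 𝓨 : Type*} [MeasurableSpace Ω] [MeasurableSpace 𝓨] {P : Measure Ω} {Q : Measure 𝓨}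
  {Y : ℕ → Ω → 𝓨}

lemma WHP.mono_eventually {E F : ℕ → Ω → Prop} (h : WHP P E)
    (hEF : ∀ᶠ n in atTop, ∀ ω, E n ω → F n ω) : WHP P F := by
  refine tendsto_of_tendsto_of_tendsto_of_le_of_le' tendsto_const_nhds h
    (Eventually.of_forall fun _ => zero_le) ?_
  filter_upwards [hEF] with n hn
  exact measure_mono fun ω hω h' => hω (hn ω h')

lemma WHP.mono {E F : ℕ → Ω → Prop} (h : WHP P E) (hEF : ∀ n ω, E n ω → F n ω) : WHP P F :=
  h.mono_eventually (Eventually.of_forall hEF)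

/-- Subadditivity of `P` holds for arbitrary sets, so the estimators need not be measurable. -/
lemma WHP.and {E F : ℕ → Ω → Prop} (hE : WHP P E) (hF : WHP P F) :
    WHP P fun n ω => E n ω ∧ F n ω := by
  have := Tendsto.add hE hF
  rw [add_zero] at this
  refine tendsto_of_tendsto_of_tendsto_of_le_of_le tendsto_const_nhds this
    (fun _ => zero_le) fun n => ?_
  refine (measure_mono fun ω hω => ?_).trans (measure_union_le {ω | ¬ E n ω} {ω | ¬ F n ω})
  by_contra h
  simp only [Set.mem_union, Set.mem_ofPred_eq, not_or, not_not] at h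
  exact hω h

lemma whp_of_ae {E : ℕ → Ω → Prop} (h : ∀ᵐ ω ∂P, ∀ n, E n ω) : WHP P E := by
  have : ∀ n, P {ω | ¬ E n ω} = 0 := fun n => by
    have := ae_all_iff.1 h n
    exact ae_iff.1 this
  simp [WHP, this]

lemma whp_all {ι : Type*} [Finite ι] {E : ι → ℕ → Ω → Prop} (h : ∀ i, WHP P (E i)) :
    WHP P fun n ω => ∀ i, E i n ω := by
  have := Fintype.ofFinite ι
  have hs : Tendsto (fun n => ∑ i, P {ω | ¬ E i n ω}) atTop (𝓝 0) := by
    simpa using tendsto_finsetSum Finset.univ fun i _ => h i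
  refine tendsto_of_tendsto_of_tendsto_of_le_of_le tendsto_const_nhds hs
    (fun _ => zero_le) fun n => ?_
  refine (measure_mono fun ω hω => ?_).trans (measure_iUnion_fintype_le P fun i => {ω | ¬ E i n ω})
  simpa using hω

lemma ae_forall_sample (hY : ∀ i, HasLaw (Y i) Q P) {q : 𝓨 → Prop} (h : ∀ᵐ y ∂Q, q y) :
    ∀ᵐ ω ∂P, ∀ i, q (Y i ω) := by
  refine ae_all_iff.2 fun i => ?_
  have h' : ∀ᵐ y ∂(P.map (Y i)), q y := by rwa [(hY i).map_eq]
  exact ae_of_ae_map (hY i).aemeasurable h'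

lemma measure_sample_le (hY : ∀ i, HasLaw (Y i) Q P) (i : ℕ) (s : Set 𝓨) :
    P {ω | Y i ω ∈ s} ≤ Q s := by
  rw [← (hY i).map_eq]
  exact Measure.le_map_apply (hY i).aemeasurable s

/-- The weak law of large numbers. -/
lemma whp_sum_sub_le [IsProbabilityMeasure P] (hY : ∀ i, HasLaw (Y i) Q P) (hi : iIndepFun Y P)
    {f : 𝓨 → ℝ} (hf : Integrable f Q) {ε : ℝ} (hε : 0 < ε) :
    WHP P fun n ω => |∑ i ∈ Finset.range n, f (Y i ω) - n * ∫ y, f y ∂Q| ≤ ε * n := by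
  -- A measurable version is needed so that independence and equality of laws pass to the
  -- compositions with `Y i`.
  obtain ⟨g, hg, hfg⟩ := hf.1
  have hgint : Integrable g Q := hf.congr hfg
  have hlaw : ∀ i, Integrable (fun ω => g (Y i ω)) P := fun i =>
    Integrable.comp_aemeasurable (by rw [(hY i).map_eq]; exact hgint) (hY i).aemeasurable
  have hEg : ∫ ω, g (Y 0 ω) ∂P = ∫ y, f y ∂Q := by
    rw [integral_congr_ae hfg, ← (hY 0).map_eq,
      integral_map (hY 0).aemeasurable (hg.aestronglyMeasurable)]
  have hsl := strong_law_ae_real (μ := P) (fun i ω => g (Y i ω)) (hlaw 0)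
    (fun i j hij => (hi.indepFun hij).comp hg.measurable hg.measurable)
    (fun i => ⟨hg.measurable.comp_aemeasurable (hY i).aemeasurable,
      hg.measurable.comp_aemeasurable (hY 0).aemeasurable, by
        have h1 := AEMeasurable.map_map_of_aemeasurable (μ := P) hg.measurable.aemeasurable
          (hY i).aemeasurable
        have h2 := AEMeasurable.map_map_of_aemeasurable (μ := P) hg.measurable.aemeasurable
          (hY 0).aemeasurable
        rw [(hY i).map_eq] at h1
        rw [(hY 0).map_eq] at h2
        exact h1.symm.trans h2⟩)
  have him := tendstoInMeasure_of_tendsto_ae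
    (fun n => ((Finset.aestronglyMeasurable_fun_sum (Finset.range n)
      (fun i _ => (hlaw i).1)).div₀ aestronglyMeasurable_const)) hsl
  rw [tendstoInMeasure_iff_norm] at him
  have h1 : WHP P fun n ω => ¬ ε ≤ ‖(∑ i ∈ Finset.range n, g (Y i ω)) / n - ∫ ω, g (Y 0 ω) ∂P‖ := by
    simpa [WHP] using him ε hε
  have h2 := whp_of_ae (P := P) (E := fun _ ω => ∀ i, f (Y i ω) = g (Y i ω)) (by
    filter_upwards [ae_forall_sample hY hfg] with ω hω using fun _ => hω)
  refine (h1.and h2).mono_eventually ?_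
  filter_upwards [eventually_gt_atTop 0] with n hn ω ⟨h3, h4⟩
  have hn' : (0 : ℝ) < n := by exact_mod_cast hn
  rw [hEg, not_le, Real.norm_eq_abs] at h3
  have h5 : ∑ i ∈ Finset.range n, f (Y i ω) - n * ∫ y, f y ∂Q =
      ((∑ i ∈ Finset.range n, g (Y i ω)) / n - ∫ y, f y ∂Q) * n := by
    rw [Finset.sum_congr rfl fun i _ => h4 i]; field_simp
  rw [h5, abs_mul, abs_of_pos hn']
  gcongr

/-- The sums of an integrable function over the sample grow at most linearly. -/
lemma exists_whp_sum_le [IsProbabilityMeasure P] (hY : ∀ i, HasLaw (Y i) Q P)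
    (hi : iIndepFun Y P) {f : 𝓨 → ℝ} (hf : Integrable f Q) :
    ∃ C > 0, WHP P fun n ω => ∑ i ∈ Finset.range n, f (Y i ω) ≤ C * n := by
  refine ⟨|∫ y, f y ∂Q| + 1, by positivity, (whp_sum_sub_le hY hi hf one_pos).mono ?_⟩
  intro n ω h
  have h1 := (abs_le.1 h).2
  have h2 := mul_le_mul_of_nonneg_left (le_abs_self (∫ y, f y ∂Q)) (Nat.cast_nonneg (α := ℝ) n)
  linarith

/-- The maximum of `n` observations of an integrable function is `o(n)` in probability. -/
lemma whp_forall_abs_le (hY : ∀ i, HasLaw (Y i) Q P)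
    {f : 𝓨 → ℝ} (hf : Integrable f Q) {ε : ℝ} (hε : 0 < ε) :
    WHP P fun n ω => ∀ i < n, |f (Y i ω)| ≤ ε * n := by
  obtain ⟨g, hg, hfg⟩ := hf.1
  have hgint : Integrable g Q := hf.congr hfg
  set S : ℕ → Set 𝓨 := fun n => {y | ε * n < |g y|}
  have hS : ∀ n, MeasurableSet (S n) := fun n =>
    measurableSet_lt measurable_const hg.measurable.abs
  -- Markov's inequality with the integral kept on the tail set. The tail integral tends to zero, so
  -- n Q(S n) → 0 and a union bound suffices.
  have hmul : ∀ n : ℕ, ENNReal.ofReal (ε * n) * Q (S n) ≤ ∫⁻ y in S n, ‖g y‖ₑ ∂Q := by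
    intro n
    rw [← setLIntegral_const]
    refine setLIntegral_mono' (hS n) fun y hy => ?_
    rw [← ofReal_norm]
    exact ENNReal.ofReal_le_ofReal (le_of_lt hy)
  have hbound : ∀ n : ℕ, (n : ENNReal) * Q (S n) ≤
      ENNReal.ofReal ε⁻¹ * ∫⁻ y in S n, ‖g y‖ₑ ∂Q := by
    intro n
    calc (n : ENNReal) * Q (S n) = ENNReal.ofReal ε⁻¹ * (ENNReal.ofReal (ε * n) * Q (S n)) := by
          rw [← mul_assoc, ← ENNReal.ofReal_mul (by positivity), ← mul_assoc,
            inv_mul_cancel₀ hε.ne', one_mul, ENNReal.ofReal_natCast]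
      _ ≤ _ := by gcongr; exact hmul n
  have hfin : ∫⁻ y, ‖g y‖ₑ ∂Q ≠ ⊤ := hgint.2.ne
  have hQS : Tendsto (fun n => Q (S n)) atTop (𝓝 0) := by
    have h1 : Tendsto (fun n : ℕ => (ENNReal.ofReal ε⁻¹ * ∫⁻ y, ‖g y‖ₑ ∂Q) / (n : ENNReal))
        atTop (𝓝 0) :=
      ENNReal.Tendsto.const_div ENNReal.tendsto_nat_nhds_top
        (Or.inr (ENNReal.mul_ne_top ENNReal.ofReal_ne_top hfin)) |>.trans (by simp)
    refine tendsto_of_tendsto_of_tendsto_of_le_of_le' tendsto_const_nhds h1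
      (Eventually.of_forall fun _ => zero_le) ?_
    filter_upwards [eventually_gt_atTop 0] with n hn
    rw [ENNReal.le_div_iff_mul_le (Or.inl (by exact_mod_cast hn.ne'))
      (Or.inl (ENNReal.natCast_ne_top n)), mul_comm]
    refine (hbound n).trans ?_
    exact mul_le_mul_right (setLIntegral_le_lintegral _ _) _
  have hlim : Tendsto (fun n : ℕ => (n : ENNReal) * Q (S n)) atTop (𝓝 0) := by
    have h1 := ENNReal.Tendsto.const_mul (a := ENNReal.ofReal ε⁻¹)
      (tendsto_setLIntegral_zero hfin hQS) (Or.inr ENNReal.ofReal_ne_top)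
    rw [mul_zero] at h1
    exact tendsto_of_tendsto_of_tendsto_of_le_of_le tendsto_const_nhds h1 (fun _ => zero_le) hbound
  have hgw : WHP P fun n ω => ∀ i < n, |g (Y i ω)| ≤ ε * n := by
    refine tendsto_of_tendsto_of_tendsto_of_le_of_le tendsto_const_nhds hlim
      (fun _ => zero_le) fun n => ?_
    calc P {ω | ¬ ∀ i < n, |g (Y i ω)| ≤ ε * n}
        ≤ P (⋃ i ∈ Finset.range n, {ω | Y i ω ∈ S n}) := by
          refine measure_mono fun ω hω => ?_
          simp only [Set.mem_ofPred_eq, not_forall, not_le] at hω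
          obtain ⟨i, hi, h⟩ := hω
          simp only [Set.mem_iUnion]
          exact ⟨i, Finset.mem_range.2 hi, h⟩
      _ ≤ ∑ i ∈ Finset.range n, P {ω | Y i ω ∈ S n} := measure_biUnion_finset_le _ _
      _ ≤ ∑ i ∈ Finset.range n, Q (S n) := Finset.sum_le_sum fun i _ => measure_sample_le hY i _
      _ = n * Q (S n) := by simp
  have h2 := whp_of_ae (P := P) (E := fun _ ω => ∀ i, f (Y i ω) = g (Y i ω)) (by
    filter_upwards [ae_forall_sample hY hfg] with ω hω using fun _ => hω)
  refine (hgw.and h2).mono fun n ω h i hi => ?_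
  rw [h.2 i]
  exact h.1 i hi

/-- If `∫ F > 0`, then all sample sums and all leave-one-out sums of `F` are positive, with
probability tending to one. -/
lemma whp_sum_pos [IsProbabilityMeasure P] (hY : ∀ i, HasLaw (Y i) Q P) (hi : iIndepFun Y P)
    {F : 𝓨 → ℝ} (hF : Integrable F Q) (hpos : 0 < ∫ y, F y ∂Q) :
    WHP P fun n ω => 0 < ∑ j ∈ Finset.range n, F (Y j ω) ∧
      ∀ i < n, 0 < ∑ j ∈ (Finset.range n).erase i, F (Y j ω) := by
  set m := ∫ y, F y ∂Q
  -- The full sum is at least 3mn/4, and deleting one term costs at most mn/4.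
  refine ((whp_sum_sub_le hY hi hF (ε := m / 4) (by positivity)).and
    (whp_forall_abs_le hY hF (ε := m / 4) (by positivity))).mono_eventually ?_
  filter_upwards [eventually_gt_atTop 0] with n hn ω ⟨h1, h2⟩
  have hn' : (0 : ℝ) < n := by exact_mod_cast hn
  have h3 := (abs_le.1 h1).1
  have h4 : 0 < m * n := by positivity
  refine ⟨by nlinarith, fun i hi => ?_⟩
  have h5 := Finset.add_sum_erase (Finset.range n) (fun j => F (Y j ω)) (Finset.mem_range.2 hi)
  have h6 := (abs_le.1 (h2 i hi)).2
  nlinarith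

/-- Tightness by continuity from above: the superlevel sets decrease to the empty set. -/
lemma exists_measure_lt_le [IsFiniteMeasure Q] {f : 𝓨 → ℝ} (hf : Measurable f) {ε : ℝ}
    (hε : 0 < ε) : ∃ M : ℝ, Q {y | M < f y} ≤ ENNReal.ofReal ε := by
  have h : Tendsto (fun n : ℕ => Q {y | (n : ℝ) < f y}) atTop (𝓝 0) := by
    have h1 := tendsto_measure_iInter_atTop (μ := Q) (s := fun n : ℕ => {y | (n : ℝ) < f y})
      (fun n => (measurableSet_lt measurable_const hf).nullMeasurableSet)
      (fun a b hab y hy => lt_of_le_of_lt (b := (b : ℝ)) (Nat.cast_le.2 hab) hy)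
      ⟨0, measure_ne_top _ _⟩
    have h2 : (⋂ n : ℕ, {y | (n : ℝ) < f y}) = ∅ := by
      ext y
      simp only [Set.mem_iInter, Set.mem_ofPred_eq, Set.mem_empty_iff_false, iff_false, not_forall,
        not_lt]
      exact exists_nat_ge (f y)
    rwa [h2, measure_empty] at h1
  have h3 := h.eventually (ge_mem_nhds (ENNReal.ofReal_pos.2 hε))
  obtain ⟨n, hn⟩ := h3.exists
  exact ⟨n, hn⟩

lemma isBigOp_of_whp {F : Type*} [Norm F] {X : ℕ → Ω → F} {r : ℕ → ℝ} {C : ℝ}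
    (h : WHP P fun n ω => ‖X n ω‖ ≤ C * r n) : IsBigOp P X r := by
  intro ε hε
  have := Filter.Tendsto.eventually h (ge_mem_nhds (ENNReal.ofReal_pos.2 hε))
  obtain ⟨N, hN⟩ := eventually_atTop.1 this
  refine ⟨C, N, fun n hn => ?_⟩
  simpa only [not_le] using hN n hn

/-- All observations have the same law, so `f (Y (i n))` is tight uniformly in `n`, however the
index moves. No moment of `f` is required. -/
lemma isBigOp_of_whp_sample [IsFiniteMeasure Q] {F : Type*} [Norm F] (hY : ∀ i, HasLaw (Y i) Q P)
    {X : ℕ → Ω → F} {r : ℕ → ℝ} (hr : ∀ n, 0 ≤ r n) {C : ℝ} (hC : 0 ≤ C) {f : 𝓨 → ℝ}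
    (hf : Measurable f) {i : ℕ → ℕ}
    (h : WHP P fun n ω => ‖X n ω‖ ≤ C * f (Y (i n) ω) * r n) : IsBigOp P X r := by
  intro ε hε
  obtain ⟨M, hM⟩ := exists_measure_lt_le (Q := Q) hf (half_pos hε)
  have := Filter.Tendsto.eventually h (ge_mem_nhds (ENNReal.ofReal_pos.2 (half_pos hε)))
  obtain ⟨N, hN⟩ := eventually_atTop.1 this
  refine ⟨C * M, N, fun n hn => ?_⟩
  calc P {ω | C * M * r n < ‖X n ω‖}
      ≤ P ({ω | ¬ ‖X n ω‖ ≤ C * f (Y (i n) ω) * r n} ∪ {ω | Y (i n) ω ∈ {y | M < f y}}) := by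
        refine measure_mono fun ω hω => ?_
        by_contra hcon
        simp only [Set.mem_union, Set.mem_ofPred_eq, not_or, not_not, not_lt] at hcon hω
        have : C * f (Y (i n) ω) * r n ≤ C * M * r n := by
          have := hr n
          gcongr
          exact hcon.2
        linarith [hcon.1]
    _ ≤ P {ω | ¬ ‖X n ω‖ ≤ C * f (Y (i n) ω) * r n} + P {ω | Y (i n) ω ∈ {y | M < f y}} :=
        measure_union_le _ _
    _ ≤ ENNReal.ofReal (ε / 2) + ENNReal.ofReal (ε / 2) :=
        add_le_add (hN n hn) ((measure_sample_le hY _ _).trans hM)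
    _ = ENNReal.ofReal ε := by
        rw [← ENNReal.ofReal_add (by positivity) (by positivity), add_halves]

end Probability

/-! ### Wald consistency and measurability of derivatives -/

section Consistency

variable {p : ℕ} {Ω 𝓨 : Type*} [MeasurableSpace Ω] [MeasurableSpace 𝓨] {P : Measure Ω}
  {Q : Measure 𝓨} {Y : ℕ → Ω → 𝓨} {Θ : Set (Param p)} {φ : Param p → 𝓨 → ℝ} {θ₀ : Param p}

/-- Fatou's lemma for integrable functions with an integrable lower bound and bounded integrals. -/
lemma integrable_of_tendsto_of_integral_le {f : ℕ → 𝓨 → ℝ} {F h : 𝓨 → ℝ} {c : ℝ}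
    (hF : AEStronglyMeasurable F Q) (hh : Integrable h Q) (hf : ∀ k, Integrable (f k) Q)
    (hlow : ∀ᵐ y ∂Q, ∀ k, h y ≤ f k y)
    (hlim : ∀ᵐ y ∂Q, Tendsto (fun k => f k y) atTop (𝓝 (F y))) (hc : ∀ k, ∫ y, f k y ∂Q ≤ c) :
    Integrable F Q ∧ ∫ y, F y ∂Q ≤ c := by
  -- Subtracting the lower bound makes the functions nonnegative, as Fatou's lemma requires.
  have hk : ∀ k, ∫⁻ y, ENNReal.ofReal (f k y - h y) ∂Q ≤ ENNReal.ofReal (c - ∫ y, h y ∂Q) := by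
    intro k
    have hint : Integrable (fun y => f k y - h y) Q := (hf k).sub hh
    rw [← ofReal_integral_eq_lintegral_ofReal hint, integral_sub (hf k) hh]
    · exact ENNReal.ofReal_le_ofReal (by linarith [hc k])
    · filter_upwards [hlow] with y hy using sub_nonneg.2 (hy k)
  have hle : ∫⁻ y, ENNReal.ofReal (F y - h y) ∂Q ≤ ENNReal.ofReal (c - ∫ y, h y ∂Q) := by
    calc ∫⁻ y, ENNReal.ofReal (F y - h y) ∂Q
        = ∫⁻ y, liminf (fun k => ENNReal.ofReal (f k y - h y)) atTop ∂Q := by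
          refine lintegral_congr_ae ?_
          filter_upwards [hlim] with y hy
          exact (ENNReal.tendsto_ofReal (hy.sub_const (h y))).liminf_eq.symm
      _ ≤ liminf (fun k => ∫⁻ y, ENNReal.ofReal (f k y - h y) ∂Q) atTop :=
          lintegral_liminf_le' fun k =>
            ((hf k).sub hh).1.aemeasurable.ennreal_ofReal
      _ ≤ liminf (fun _ : ℕ => ENNReal.ofReal (c - ∫ y, h y ∂Q)) atTop :=
          liminf_le_liminf (Eventually.of_forall hk)
      _ = _ := liminf_const _
  have hnn : 0 ≤ᵐ[Q] fun y => F y - h y := by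
    filter_upwards [hlow, hlim] with y h1 h2
    exact sub_nonneg.2 (ge_of_tendsto' h2 h1)
  have hint : Integrable (fun y => F y - h y) Q := by
    refine ⟨hF.sub hh.1, ?_⟩
    rw [hasFiniteIntegral_iff_ofReal hnn]
    exact hle.trans_lt ENNReal.ofReal_lt_top
  have hFint : Integrable F Q :=
    (hint.add hh).congr (Eventually.of_forall fun y => by simp)
  refine ⟨hFint, ?_⟩
  have h0 : 0 ≤ c - ∫ y, h y ∂Q := by
    have : ∫ y, h y ∂Q ≤ ∫ y, f 0 y ∂Q := integral_mono_ae hh (hf 0) (by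
      filter_upwards [hlow] with y hy using hy 0)
    linarith [hc 0]
  have := (ofReal_integral_eq_lintegral_ofReal hint hnn).trans_le hle
  rw [ENNReal.ofReal_le_ofReal_iff h0, integral_sub hFint hh] at this
  linarith

/-- Near a parameter that is not the minimiser, the loss has an integrable lower bound whose
expected value exceeds the minimum. -/
lemma exists_local_lower_bound [IsFiniteMeasure Q]
    (hφ_meas : ∀ θ ∈ Θ, Measurable (φ θ)) (hφ_cont : ∀ y, ContinuousOn (fun θ => φ θ y) Θ)
    (hφ_int : Integrable (φ θ₀) Q)
    (hmin : ∀ θ ∈ Θ, θ ≠ θ₀ → Integrable (φ θ) Q → ∫ y, φ θ₀ y ∂Q < ∫ y, φ θ y ∂Q)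
    (hlower : ∀ θ ∈ Θ, ∃ r : ℝ, 0 < r ∧ ∃ h : 𝓨 → ℝ, Integrable h Q ∧
      ∀ᵐ y ∂Q, ∀ t ∈ Θ ∩ Metric.ball θ r, h y ≤ φ t y)
    {θ : Param p} (hθ : θ ∈ Θ) (hne : θ ≠ θ₀) :
    ∃ ρ > 0, ∃ F : 𝓨 → ℝ, Integrable F Q ∧ 0 < ∫ y, F y ∂Q ∧
      ∀ᵐ y ∂Q, ∀ t ∈ Θ ∩ Metric.ball θ ρ, F y ≤ φ t y - φ θ₀ y := by
  obtain ⟨r, hr, h, hh, hlow⟩ := hlower θ hθ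
  obtain ⟨D, hDΘ, hDc, hΘD⟩ :=
    (TopologicalSpace.IsSeparable.of_separableSpace Θ).exists_countable_dense_subset
  set ρ : ℕ → ℝ := fun k => r / (k + 1)
  have hρ : ∀ k, 0 < ρ k := fun k => by positivity
  have hρr : ∀ k, ρ k ≤ r := fun k => by
    refine div_le_self hr.le ?_
    have : (0 : ℝ) ≤ k := Nat.cast_nonneg k
    linarith
  set V : ℕ → Set (Param p) := fun k => D ∩ Metric.ball θ (ρ k)
  have hVc : ∀ k, Countable (V k) := fun k => (hDc.mono Set.inter_subset_left).to_subtype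
  have hVne : ∀ k, Nonempty (V k) := fun k => by
    obtain ⟨s, hs, hsD⟩ := mem_closure_iff.1 (hΘD hθ) _ Metric.isOpen_ball
      (Metric.mem_ball_self (hρ k))
    exact ⟨⟨s, hsD, hs⟩⟩
  have hVΘ : ∀ k (s : V k), (s : Param p) ∈ Θ ∩ Metric.ball θ r := fun k s =>
    ⟨hDΘ s.2.1, Metric.ball_subset_ball (hρr k) s.2.2⟩
  -- The infimum runs over a countable dense set to be measurable, and truncation at `k` makes it
  -- integrable. As the balls shrink and the level rises, `f k` tends to `φ θ` by continuity.
  set f : ℕ → 𝓨 → ℝ := fun k y => min (k : ℝ) (⨅ s : V k, φ s y)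
  have hfm : ∀ k, Measurable (f k) := fun k =>
    measurable_const.min (Measurable.iInf fun s => hφ_meas _ (hVΘ k s).1)
  have hbdd : ∀ y, (∀ t ∈ Θ ∩ Metric.ball θ r, h y ≤ φ t y) →
      ∀ k, BddBelow (Set.range fun s : V k => φ s y) := by
    intro y hy k
    refine ⟨h y, ?_⟩
    rintro _ ⟨s, rfl⟩
    exact hy s (hVΘ k s)
  have hflow : ∀ y, (∀ t ∈ Θ ∩ Metric.ball θ r, h y ≤ φ t y) → ∀ k, min 0 (h y) ≤ f k y :=
    fun y hy k => min_le_min (Nat.cast_nonneg k) (le_ciInf fun s => hy s (hVΘ k s))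
  have hfup : ∀ y, (∀ t ∈ Θ ∩ Metric.ball θ r, h y ≤ φ t y) → ∀ k,
      ∀ t ∈ Θ ∩ Metric.ball θ (ρ k), f k y ≤ φ t y := by
    intro y hy k t ht
    have hmem : t ∈ closure (D ∩ Metric.ball θ (ρ k)) :=
      Metric.isOpen_ball.closure_inter ⟨hΘD ht.1, ht.2⟩
    have hcont : ContinuousWithinAt (fun s => φ s y) (D ∩ Metric.ball θ (ρ k)) t :=
      (hφ_cont y t ht.1).mono (Set.inter_subset_left.trans hDΘ)
    have := mem_closure_iff_nhdsWithin_neBot.1 hmem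
    refine ge_of_tendsto hcont ?_
    filter_upwards [self_mem_nhdsWithin] with s hs
    exact (min_le_right _ _).trans (ciInf_le (hbdd y hy k) (⟨s, hs⟩ : V k))
  have hflim : ∀ y, (∀ t ∈ Θ ∩ Metric.ball θ r, h y ≤ φ t y) →
      Tendsto (fun k => f k y) atTop (𝓝 (φ θ y)) := by
    intro y hy
    refine tendsto_order.2 ⟨fun c hc => ?_, fun c hc => ?_⟩
    · obtain ⟨c', hc', hc'2⟩ := exists_between hc
      have hev : ∀ᶠ t in 𝓝[Θ] θ, c' < φ t y := (hφ_cont y θ hθ).eventually_const_lt hc'2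
      obtain ⟨δ, hδ, hδ'⟩ := Metric.mem_nhdsWithin_iff.1 hev
      have hlimρ : Tendsto ρ atTop (𝓝 0) := by
        have := (tendsto_one_div_add_atTop_nhds_zero_nat (𝕜 := ℝ)).const_mul r
        simpa [ρ, div_eq_mul_inv] using this
      filter_upwards [hlimρ.eventually_lt_const hδ, eventually_ge_atTop ⌈c'⌉₊] with k hk hk2
      refine hc'.trans_le (le_min ((Nat.le_ceil c').trans (Nat.cast_le.2 hk2)) ?_)
      refine le_ciInf fun s => le_of_lt ?_
      exact hδ' ⟨Metric.ball_subset_ball hk.le s.2.2, (hVΘ k s).1⟩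
    · exact Eventually.of_forall fun k =>
        (hfup y hy k θ ⟨hθ, Metric.mem_ball_self (hρ k)⟩).trans_lt hc
  have hh0 : Integrable (fun y => min 0 (h y)) Q := (integrable_const 0).inf hh
  have hfint : ∀ k, Integrable (f k) Q := by
    intro k
    refine (hh.norm.add (integrable_const (k : ℝ))).mono' (hfm k).aestronglyMeasurable ?_
    filter_upwards [hlow] with y hy
    have h1 := hflow y hy k
    have h2 : f k y ≤ k := min_le_left _ _
    have h3 : -|h y| ≤ min 0 (h y) := le_min (by simp) (neg_abs_le _)
    have h4 := abs_nonneg (h y)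
    have h5 : (0 : ℝ) ≤ k := Nat.cast_nonneg k
    simp only [Pi.add_apply, Real.norm_eq_abs]
    exact abs_le.2 ⟨by linarith, by linarith⟩
  -- Otherwise Fatou would make `φ θ` integrable with expectation at most that of `φ θ₀`. This also
  -- settles the case of infinite expected loss at `θ`.
  obtain ⟨k, hk⟩ : ∃ k, ∫ y, φ θ₀ y ∂Q < ∫ y, f k y ∂Q := by
    by_contra! hcon
    obtain ⟨h1, h2⟩ := integrable_of_tendsto_of_integral_le
      (hφ_meas θ hθ).aestronglyMeasurable hh0 hfint
      (by filter_upwards [hlow] with y hy using hflow y hy)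
      (by filter_upwards [hlow] with y hy using hflim y hy) hcon
    exact absurd h2 (not_le.2 (hmin θ hθ hne h1))
  refine ⟨ρ k, hρ k, fun y => f k y - φ θ₀ y, (hfint k).sub hφ_int, ?_, ?_⟩
  · rw [integral_sub (hfint k) hφ_int]; linarith
  · filter_upwards [hlow] with y hy t ht
    linarith [hfup y hy k t ht]

/-- Wald's consistency argument, simultaneously for the full sample and all leave-one-out
samples: away from `θ₀` a compact set contains no minimiser, with probability tending to one. -/
lemma whp_not_isArgmin [IsProbabilityMeasure P] [IsFiniteMeasure Q]
    (hY : ∀ i, HasLaw (Y i) Q P) (hi : iIndepFun Y P)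
    (hφ_meas : ∀ θ ∈ Θ, Measurable (φ θ)) (hφ_cont : ∀ y, ContinuousOn (fun θ => φ θ y) Θ)
    (hθ₀ : θ₀ ∈ Θ) (hφ_int : Integrable (φ θ₀) Q)
    (hmin : ∀ θ ∈ Θ, θ ≠ θ₀ → Integrable (φ θ) Q → ∫ y, φ θ₀ y ∂Q < ∫ y, φ θ y ∂Q)
    (hlower : ∀ θ ∈ Θ, ∃ r : ℝ, 0 < r ∧ ∃ h : 𝓨 → ℝ, Integrable h Q ∧
      ∀ᵐ y ∂Q, ∀ t ∈ Θ ∩ Metric.ball θ r, h y ≤ φ t y)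
    {K : Set (Param p)} (hK : IsCompact K) (hKΘ : K ⊆ Θ) (hKθ : θ₀ ∉ K) :
    WHP P fun n ω => ∀ t ∈ K, ¬ IsArgmin (empRisk φ (fun j => Y j ω) n) Θ t ∧
      ∀ i < n, ¬ IsArgmin (looRisk φ (fun j => Y j ω) n i) Θ t := by
  -- Compactness reduces the claim to small balls, where one integrable `F` of positive mean bounds
  -- the excess loss from below.
  refine hK.induction_on (p := fun K => WHP P fun n ω =>
    ∀ t ∈ K, ¬ IsArgmin (empRisk φ (fun j => Y j ω) n) Θ t ∧
      ∀ i < n, ¬ IsArgmin (looRisk φ (fun j => Y j ω) n i) Θ t) ?_ ?_ ?_ ?_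
  · exact whp_of_ae (Eventually.of_forall fun ω n t ht => absurd ht (Set.notMem_empty t))
  · intro s t hst ht
    exact ht.mono fun n ω h x hx => h x (hst hx)
  · intro s t hs ht
    refine (hs.and ht).mono fun n ω h x hx => ?_
    rcases hx with hx | hx
    · exact h.1 x hx
    · exact h.2 x hx
  · intro θ hθ
    obtain ⟨ρ, hρ, F, hF, hFpos, hFle⟩ := exists_local_lower_bound hφ_meas hφ_cont hφ_int hmin
      hlower (hKΘ hθ) (fun h => hKθ (h ▸ hθ))
    refine ⟨K ∩ Metric.ball θ ρ, inter_mem_nhdsWithin K (Metric.ball_mem_nhds θ hρ), ?_⟩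
    refine ((whp_sum_pos hY hi hF hFpos).and (whp_of_ae
      (E := fun _ ω => ∀ j, ∀ t ∈ Θ ∩ Metric.ball θ ρ, F (Y j ω) ≤ φ t (Y j ω) - φ θ₀ (Y j ω))
      (by filter_upwards [ae_forall_sample hY hFle] with ω hω using fun _ => hω))).mono_eventually ?_
    filter_upwards [eventually_gt_atTop 1] with n hn ω ⟨⟨h1, h2⟩, h3⟩ t ht
    have hn' : (1 : ℝ) < n := by exact_mod_cast hn
    have key : ∀ (u : Finset ℕ) (c : ℝ), 0 < c → 0 < ∑ j ∈ u, F (Y j ω) →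
        c * ∑ j ∈ u, φ θ₀ (Y j ω) < c * ∑ j ∈ u, φ t (Y j ω) := by
      intro u c hc hu
      refine mul_lt_mul_of_pos_left ?_ hc
      have := Finset.sum_le_sum fun j (_ : j ∈ u) => h3 j t ⟨hKΘ ht.1, ht.2⟩
      rw [Finset.sum_sub_distrib] at this
      linarith
    refine ⟨fun h => ?_, fun i hi h => ?_⟩
    · exact absurd (h.2 θ₀ hθ₀) (not_le.2 (key _ _ (by positivity) h1))
    · exact absurd (h.2 θ₀ hθ₀) (not_le.2 (key _ _ (inv_pos.2 (by linarith)) (h2 i hi)))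

/-- A directional derivative is a pointwise limit of difference quotients; shifting their index by
`N` keeps all base points in `U`. -/
lemma measurable_fderiv_apply {f : Param p → 𝓨 → ℝ} {U : Set (Param p)} (hU : IsOpen U)
    (hf : ∀ θ ∈ U, Measurable (f θ)) {θ : Param p} (hθ : θ ∈ U)
    (hd : ∀ y, DifferentiableAt ℝ (fun t => f t y) θ) (v : Param p) :
    Measurable fun y => fderiv ℝ (fun t => f t y) θ v := by
  have hc : Tendsto (fun n : ℕ => θ + ((n : ℝ))⁻¹ • v) atTop (𝓝 θ) := by
    simpa using tendsto_const_nhds.add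
      ((tendsto_inv_atTop_nhds_zero_nat (𝕜 := ℝ)).smul_const v)
  obtain ⟨N, hN⟩ := eventually_atTop.1 (hc.eventually (hU.mem_nhds hθ))
  refine measurable_of_tendsto_metrizable
    (f := fun n : ℕ => fun y => ((n + N : ℕ) : ℝ) • (f (θ + ((n + N : ℕ) : ℝ)⁻¹ • v) y - f θ y))
    (fun n => by
      simp only [smul_eq_mul]
      exact ((hf _ (hN _ (Nat.le_add_left N n))).sub (hf θ hθ)).const_mul _) ?_
  refine tendsto_pi_nhds.2 fun y => ?_
  refine (hd y).hasFDerivAt.lim v (c := fun n : ℕ => ((n + N : ℕ) : ℝ)) ?_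
  simp only [Real.norm_natCast]
  exact tendsto_natCast_atTop_atTop.comp (tendsto_add_atTop_nat N)

lemma measurable_hessMatrix (hφ_meas : ∀ θ ∈ Θ, Measurable (φ θ))
    (hφ_diff : ∀ y, DiffTimesOn 3 (fun θ => φ θ y) (interior Θ)) {θ : Param p}
    (hθ : θ ∈ interior Θ) (a b : Fin p) :
    Measurable fun y => hessMatrix (fun t => φ t y) θ a b := by
  have h1 : ∀ t ∈ interior Θ, Measurable fun y =>
      fderiv ℝ (fun t => φ t y) t (EuclideanSpace.single b 1) := fun t ht =>
    measurable_fderiv_apply isOpen_interior (fun θ hθ => hφ_meas θ (interior_subset hθ)) ht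
      (fun y => (hφ_diff y).differentiableAt ht) _
  have hd : ∀ y, DifferentiableAt ℝ (fderiv ℝ (fun t => φ t y)) θ := fun y =>
    (hφ_diff y).differentiableAt_fderiv hθ
  have h2 := measurable_fderiv_apply isOpen_interior h1 hθ
    (fun y => (hd y).clm_apply (differentiableAt_const _)) (EuclideanSpace.single a 1)
  convert h2 using 2 with y
  rw [hessMatrix_apply, fderiv_clm_apply (hd y) (differentiableAt_const _)]
  simp

end Consistency

/-! ### Expansion of the leave-one-out displacement and of the criterion -/

section Expansion

variable {p : ℕ} {𝓨 : Type*} {φ : Param p → 𝓨 → ℝ} {y : ℕ → 𝓨} {n i : ℕ}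

lemma hessMatrix_empRisk {x : Param p} (hφ : ∀ j, ContDiffAt ℝ 2 (fun t => φ t (y j)) x) :
    hessMatrix (empRisk φ y n) x =
      (n : ℝ)⁻¹ • ∑ j ∈ Finset.range n, hessMatrix (fun t => φ t (y j)) x :=
  hessMatrix_const_mul_sum (Finset.range n) _ (fun j t => φ t (y j)) fun j _ => hφ j

lemma sum_gradient_eq_zero {Θ : Set (Param p)} {u : Finset ℕ} {a : ℝ} (ha : a ≠ 0) {x : Param p}
    (hφ : ∀ j, DifferentiableAt ℝ (fun t => φ t (y j)) x)
    (h : IsArgmin (fun t => a * ∑ j ∈ u, φ t (y j)) Θ x) (hx : x ∈ interior Θ) :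
    ∑ j ∈ u, gradient (fun t => φ t (y j)) x = 0 := by
  have h1 := h.gradient_eq_zero hx
  rw [gradient_const_mul_sum u a (fun j t => φ t (y j)) fun j _ => hφ j] at h1
  exact (smul_eq_zero.1 h1).resolve_left ha

lemma norm_dHat_le {B : ℝ} {x : Param p} (hn : 2 ≤ n)
    (hB : ‖iteratedFDeriv ℝ 1 (fun t => φ t (y i)) x‖ ≤ B) :
    ‖dHat φ y n i x‖ ≤ 2 * B / n := by
  have hn' : (2 : ℝ) ≤ n := by exact_mod_cast hn
  have hB0 : 0 ≤ B := (norm_nonneg _).trans hB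
  rw [dHat, norm_smul, norm_gradient_eq, Real.norm_eq_abs, abs_of_nonneg (by
    have : (0 : ℝ) ≤ n - 1 := by linarith
    positivity), inv_mul_eq_div, div_le_div_iff₀ (by linarith) (by linarith)]
  nlinarith [norm_nonneg (iteratedFDeriv ℝ 1 (fun t => φ t (y i)) x)]

/-- The remainder of the linear equation satisfied by the leave-one-out displacement. -/
lemma norm_hess_displacement_sub_dHat_le {Θ : Set (Param p)} {s : Set (Param p)} {x z : Param p}
    {B₂ B₃ : ℕ → ℝ} {c b : ℝ} (hs : IsOpen s) (hsc : Convex ℝ s) (hsΘ : s ⊆ interior Θ)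
    (hφ : ∀ j, DiffTimesOn 3 (fun t => φ t (y j)) s)
    (hB₂ : ∀ j, ∀ t ∈ s, ‖iteratedFDeriv ℝ 2 (fun t => φ t (y j)) t‖ ≤ B₂ j)
    (hB₃ : ∀ j, ∀ t ∈ s, ‖iteratedFDeriv ℝ 3 (fun t => φ t (y j)) t‖ ≤ B₃ j)
    (hn : 2 ≤ n) (hi : i < n) (hx : x ∈ s) (hz : z ∈ s)
    (hxmin : IsArgmin (empRisk φ y n) Θ x) (hzmin : IsArgmin (looRisk φ y n i) Θ z)
    (hH : ∀ v, ‖Matrix.toEuclideanLin (hessMatrix (empRisk φ y n) x) v‖ ≤ c * ‖v‖)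
    (hb : ∑ j ∈ Finset.range n, B₃ j ≤ b * n) :
    ((n : ℝ) - 1) * ‖Matrix.toEuclideanLin (hessMatrix (empRisk φ y n) x) (z - x) -
      dHat φ y n i x‖ ≤ (c + B₂ i + b * n * ‖z - x‖) * ‖z - x‖ := by
  have hn' : (2 : ℝ) ≤ n := by exact_mod_cast hn
  have hn1 : (0 : ℝ) < n - 1 := by linarith
  have hcd : ∀ j, ∀ t ∈ s, ContDiffAt ℝ 2 (fun t => φ t (y j)) t := fun j t ht =>
    (hφ j).contDiffAt hs ht
  have hd : ∀ j, ∀ t ∈ s, DifferentiableAt ℝ (fun t => φ t (y j)) t := fun j t ht =>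
    (hφ j).differentiableAt ht
  have him : i ∈ Finset.range n := Finset.mem_range.2 hi
  have hgx : ∑ j ∈ Finset.range n, gradient (fun t => φ t (y j)) x = 0 :=
    sum_gradient_eq_zero (a := (n : ℝ)⁻¹) (by positivity) (fun j => hd j x hx) hxmin (hsΘ hx)
  have hgz : ∑ j ∈ (Finset.range n).erase i, gradient (fun t => φ t (y j)) z = 0 :=
    sum_gradient_eq_zero (a := ((n : ℝ) - 1)⁻¹) (inv_ne_zero hn1.ne')
      (fun j => hd j z hz) hzmin (hsΘ hz)
  set H := Matrix.toEuclideanLin (hessMatrix (empRisk φ y n) x)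
  set T : ℕ → Param p := fun j => Matrix.toEuclideanLin (hessMatrix (fun t => φ t (y j)) x) (z - x)
  have hT : ∑ j ∈ Finset.range n, T j = (n : ℝ) • H (z - x) := by
    simp only [H, T, hessMatrix_empRisk (fun j => hcd j x hx), map_smul, map_sum,
      LinearMap.smul_apply, LinearMap.sum_apply]
    rw [smul_inv_smul₀ (by positivity)]
  set R : Param p := ∑ j ∈ (Finset.range n).erase i,
    (gradient (fun t => φ t (y j)) z - gradient (fun t => φ t (y j)) x - T j)
  have hR : ‖R‖ ≤ b * n * ‖z - x‖ ^ 2 := by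
    calc ‖R‖ ≤ ∑ j ∈ (Finset.range n).erase i, B₃ j * ‖z - x‖ ^ 2 :=
          norm_sum_le_of_le _ fun j _ =>
            (hφ j).norm_gradient_taylor_le hs hsc (hB₃ j) hx hz
      _ ≤ ∑ j ∈ Finset.range n, B₃ j * ‖z - x‖ ^ 2 :=
          Finset.sum_le_sum_of_subset_of_nonneg (Finset.erase_subset _ _) fun j _ _ => by
            have := (norm_nonneg _).trans (hB₃ j x hx)
            positivity
      _ ≤ b * n * ‖z - x‖ ^ 2 := by rw [← Finset.sum_mul]; gcongr
  -- At `z` the gradients over j ≠ i sum to zero; at `x` all of them do, so those over j ≠ i sum to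
  -- minus the i-th one.
  have hRe : R = gradient (fun t => φ t (y i)) x - (n : ℝ) • H (z - x) + T i := by
    have h1 := Finset.add_sum_erase _ (fun j => gradient (fun t => φ t (y j)) x) him
    have h2 := Finset.add_sum_erase _ T him
    rw [hgx] at h1
    rw [hT] at h2
    simp only [R, Finset.sum_sub_distrib, hgz]
    rw [eq_neg_of_add_eq_zero_right h1, ← h2]
    abel
  have hdh : ((n : ℝ) - 1) • dHat φ y n i x = gradient (fun t => φ t (y i)) x := by
    rw [dHat, smul_inv_smul₀ hn1.ne']
  have hmain : ((n : ℝ) - 1) • (H (z - x) - dHat φ y n i x) = -H (z - x) + T i - R := by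
    rw [smul_sub, hdh, hRe, sub_smul, one_smul]
    abel
  have hTi : ‖T i‖ ≤ B₂ i * ‖z - x‖ :=
    (norm_toEuclideanLin_hessMatrix_le (hcd i x hx) _).trans (by gcongr; exact hB₂ i x hx)
  calc ((n : ℝ) - 1) * ‖H (z - x) - dHat φ y n i x‖
      = ‖-H (z - x) + T i - R‖ := by
        rw [← hmain, norm_smul, Real.norm_eq_abs, abs_of_pos hn1]
    _ ≤ ‖H (z - x)‖ + ‖T i‖ + ‖R‖ := by
        refine (norm_sub_le _ _).trans ?_
        gcongr
        exact (norm_add_le _ _).trans (by rw [norm_neg])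
    _ ≤ c * ‖z - x‖ + B₂ i * ‖z - x‖ + b * n * ‖z - x‖ ^ 2 :=
        add_le_add (add_le_add (hH _) hTi) hR
    _ = _ := by ring

/-- Approximate solutions of `H Δ = d` with a remainder that is small relative to `Δ`. -/
lemma displacement_bounds {M : Matrix (Fin p) (Fin p) ℝ} {d Δ : Param p} {c b B₁ B₂ N : ℝ}
    (hc : 0 < c) (hb : 0 < b) (hB₁ : 0 ≤ B₁) (hB₂ : 0 ≤ B₂) (hN : 2 ≤ N) (hdet : M.det ≠ 0)
    (hM : ∀ v, ‖Matrix.toEuclideanLin M⁻¹ v‖ ≤ c * ‖v‖)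
    (hw : (N - 1) * ‖Matrix.toEuclideanLin M Δ - d‖ ≤ (c + B₂ + b * N * ‖Δ‖) * ‖Δ‖)
    (hd : ‖d‖ ≤ 2 * B₁ / N) (h1 : 12 * c ^ 2 ≤ N) (h2 : 12 * c * B₂ ≤ N)
    (h3 : 12 * c * b * ‖Δ‖ ≤ 1) :
    ‖Δ‖ ≤ 4 * c * (B₁ / N) ∧
      ‖Δ - Matrix.toEuclideanLin M⁻¹ d‖ ≤
        (8 * c ^ 3 + 8 * c ^ 2 + 32 * b * c ^ 3) * (B₁ * (1 + B₁ + B₂)) * (N ^ 2)⁻¹ := by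
  have hN0 : 0 < N := by linarith
  set w := Matrix.toEuclideanLin M Δ - d
  have hu : Δ - Matrix.toEuclideanLin M⁻¹ d = Matrix.toEuclideanLin M⁻¹ w := by
    rw [map_sub, toEuclideanLin_inv_apply_self hdet]
  have hul : ‖Δ - Matrix.toEuclideanLin M⁻¹ d‖ ≤ c * ‖w‖ := hu ▸ hM w
  -- Uses N ≤ 2(N - 1).
  have hw2 : N * ‖w‖ ≤ 2 * ((c + B₂ + b * N * ‖Δ‖) * ‖Δ‖) := by
    nlinarith [norm_nonneg w]
  have hΔ0 := norm_nonneg Δ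
  -- Absorption: by `h1`, `h2`, `h3` each of the three summands, times 4c, is at most N/3. Half of
  -- ‖Δ‖ then remains to be bounded by H⁻¹d.
  have hw3 : c * ‖w‖ ≤ ‖Δ‖ / 2 := by
    have h4 : 4 * c * (c + B₂ + b * N * ‖Δ‖) ≤ N := by nlinarith
    have h5 : N * (c * ‖w‖) ≤ N * (‖Δ‖ / 2) := by
      calc N * (c * ‖w‖) = c * (N * ‖w‖) := by ring
        _ ≤ c * (2 * ((c + B₂ + b * N * ‖Δ‖) * ‖Δ‖)) := by gcongr
        _ = 4 * c * (c + B₂ + b * N * ‖Δ‖) * (‖Δ‖ / 2) := by ring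
        _ ≤ N * (‖Δ‖ / 2) := by gcongr
    exact le_of_mul_le_mul_left h5 hN0
  have hΔ : ‖Δ‖ ≤ 4 * c * (B₁ / N) := by
    have h4 : ‖Δ‖ ≤ ‖Δ - Matrix.toEuclideanLin M⁻¹ d‖ + ‖Matrix.toEuclideanLin M⁻¹ d‖ := by
      simpa using norm_add_le (Δ - Matrix.toEuclideanLin M⁻¹ d) (Matrix.toEuclideanLin M⁻¹ d)
    have h5 : ‖Matrix.toEuclideanLin M⁻¹ d‖ ≤ c * (2 * B₁ / N) := (hM d).trans (by gcongr)
    have h6 : c * (2 * B₁ / N) = 2 * c * (B₁ / N) := by ring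
    linarith
  refine ⟨hΔ, hul.trans ?_⟩
  rw [← div_eq_mul_inv, le_div_iff₀ (by positivity)]
  -- The size of Δ just obtained is put back into the remainder, improving its order to N⁻².
  have hq : N * ‖Δ‖ ≤ 4 * c * B₁ := by
    calc N * ‖Δ‖ ≤ N * (4 * c * (B₁ / N)) := by gcongr
      _ = 4 * c * B₁ := by field_simp
  calc c * ‖w‖ * N ^ 2 = c * N * (N * ‖w‖) := by ring
    _ ≤ c * N * (2 * ((c + B₂ + b * N * ‖Δ‖) * ‖Δ‖)) := by gcongr
    _ = 2 * c * (c + B₂ + b * (N * ‖Δ‖)) * (N * ‖Δ‖) := by ring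
    _ ≤ 2 * c * (c + B₂ + b * (4 * c * B₁)) * (4 * c * B₁) := by gcongr
    _ ≤ (8 * c ^ 3 + 8 * c ^ 2 + 32 * b * c ^ 3) * (B₁ * (1 + B₁ + B₂)) := by
      have e : (8 * c ^ 3 + 8 * c ^ 2 + 32 * b * c ^ 3) * (B₁ * (1 + B₁ + B₂)) -
          2 * c * (c + B₂ + b * (4 * c * B₁)) * (4 * c * B₁) =
          8 * c ^ 3 * (B₁ * (B₁ + B₂)) + 8 * c ^ 2 * (B₁ * (1 + B₁)) +
            32 * b * c ^ 3 * (B₁ * (1 + B₂)) := by ring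
      have : 0 ≤ 8 * c ^ 3 * (B₁ * (B₁ + B₂)) + 8 * c ^ 2 * (B₁ * (1 + B₁)) +
            32 * b * c ^ 3 * (B₁ * (1 + B₂)) := by positivity
      linarith

lemma hessMatrix_empRisk_transpose {x : Param p}
    (hφ : ∀ j, ContDiffAt ℝ 2 (fun t => φ t (y j)) x) :
    (hessMatrix (empRisk φ y n) x).transpose = hessMatrix (empRisk φ y n) x := by
  have : ContDiffAt ℝ 2 (empRisk φ y n) x :=
    contDiffAt_const.mul (ContDiffAt.sum fun j _ => hφ j)
  ext a b
  exact hessMatrix_comm this b a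

/-- The trace correction is the average of the linear Taylor terms ⟨v̂ᵢ, H⁻¹d̂ᵢ⟩. Symmetry of H⁻¹
moves it from v̂ᵢ to d̂ᵢ. -/
lemma cvCrit_sub_uacv {g : Param p → 𝓨 → ℝ} {ψ : (𝓨 → ℝ) → 𝓨 → ℝ} {x : Param p}
    {θm : ℕ → Param p} (hsymm : (hessMatrix (empRisk φ y n) x).transpose =
      hessMatrix (empRisk φ y n) x) :
    cvCrit g ψ y n θm - uacv φ g ψ y n x = (n : ℝ)⁻¹ * ∑ i ∈ Finset.range n,
      (ψ (g (θm i)) (y i) - ψ (g x) (y i) - inner ℝ (vHat g ψ y i x)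
        (Matrix.toEuclideanLin (hessMatrix (empRisk φ y n) x)⁻¹ (dHat φ y n i x))) := by
  have hinv : (hessMatrix (empRisk φ y n) x)⁻¹.transpose = (hessMatrix (empRisk φ y n) x)⁻¹ := by
    rw [Matrix.transpose_nonsing_inv, hsymm]
  have htr : Matrix.trace ((hessMatrix (empRisk φ y n) x)⁻¹ * kMatrix φ g ψ y n x) =
      (n : ℝ)⁻¹ * ∑ i ∈ Finset.range n, inner ℝ (vHat g ψ y i x)
        (Matrix.toEuclideanLin (hessMatrix (empRisk φ y n) x)⁻¹ (dHat φ y n i x)) := by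
    rw [kMatrix, Matrix.mul_smul, Matrix.trace_smul, Matrix.mul_sum, Matrix.trace_sum, smul_eq_mul]
    congr 1
    refine Finset.sum_congr rfl fun i _ => ?_
    rw [trace_mul_outer, inner_toEuclideanLin_comm hinv]
  rw [cvCrit, uacv, htr, Finset.sum_sub_distrib, Finset.sum_sub_distrib]
  ring

/-- Two errors add up: the Taylor remainder, governed by the size of the displacement, and the
gradient tested against the error of its approximation `u`. -/
lemma abs_cv_term_le {f : Param p → ℝ} {s : Set (Param p)} {x z u : Param p} {C₁ C₂ a e : ℝ}
    (hf : DiffTimesOn 2 f s) (hsc : Convex ℝ s)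
    (hC₁ : ∀ t ∈ s, ‖iteratedFDeriv ℝ 1 f t‖ ≤ C₁) (hC₂ : ∀ t ∈ s, ‖iteratedFDeriv ℝ 2 f t‖ ≤ C₂)
    (hx : x ∈ s) (hz : z ∈ s) (ha : ‖z - x‖ ≤ a) (he : ‖z - x - u‖ ≤ e) :
    |f z - f x - inner ℝ (gradient f x) u| ≤ C₂ * a ^ 2 + C₁ * e := by
  have hC₂0 := (norm_nonneg _).trans (hC₂ x hx)
  have hC₁0 := (norm_nonneg _).trans (hC₁ x hx)
  have h1 := (hf.abs_taylor_le hsc hC₂ hx hz).trans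
    (mul_le_mul_of_nonneg_left (pow_le_pow_left₀ (norm_nonneg _) ha 2) hC₂0)
  have h2 : |inner ℝ (gradient f x) (z - x - u)| ≤ C₁ * e := by
    refine (abs_real_inner_le_norm _ _).trans ?_
    rw [norm_gradient_eq]
    exact mul_le_mul (hC₁ x hx) he (norm_nonneg _) hC₁0
  have h3 : f z - f x - inner ℝ (gradient f x) u =
      (f z - f x - inner ℝ (gradient f x) (z - x)) + inner ℝ (gradient f x) (z - x - u) := by
    rw [inner_sub_right _ (z - x) u]; ring
  rw [h3]
  exact (abs_add_le _ _).trans (add_le_add h1 h2)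

end Expansion

/-! ### Convergence of the sample Hessian -/

section Hessian

variable {p : ℕ} {𝓨 : Type*} {φ : Param p → 𝓨 → ℝ} {θ₀ : Param p}

/-- Near `θ₀` the sample Hessian is close to the expected Hessian. -/
lemma abs_hessMatrix_empRisk_sub_le {s : Set (Param p)} {y : ℕ → 𝓨} {n : ℕ}
    {B₃ : ℕ → ℝ} {b ε δ : ℝ} {x : Param p} {M : Matrix (Fin p) (Fin p) ℝ}
    (hs : IsOpen s) (hsc : Convex ℝ s) (hφ : ∀ j, DiffTimesOn 3 (fun t => φ t (y j)) s)
    (hB₃ : ∀ j, ∀ t ∈ s, ‖iteratedFDeriv ℝ 3 (fun t => φ t (y j)) t‖ ≤ B₃ j)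
    (hn : 0 < n) (hb : ∑ j ∈ Finset.range n, B₃ j ≤ b * n) (hx : x ∈ s) (hθ₀ : θ₀ ∈ s)
    (hxδ : ‖x - θ₀‖ ≤ δ) (a a' : Fin p)
    (hM : |∑ j ∈ Finset.range n, hessMatrix (fun t => φ t (y j)) θ₀ a a' - n * M a a'| ≤ ε * n) :
    |hessMatrix (empRisk φ y n) x a a' - M a a'| ≤ b * δ + ε := by
  have hn' : (0 : ℝ) < n := by exact_mod_cast hn
  have h1 : hessMatrix (empRisk φ y n) x a a' =
      (n : ℝ)⁻¹ * ∑ j ∈ Finset.range n, hessMatrix (fun t => φ t (y j)) x a a' := by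
    rw [hessMatrix_empRisk fun j => (hφ j).contDiffAt hs hx]
    simp [Matrix.sum_apply]
  have h2 : |∑ j ∈ Finset.range n, (hessMatrix (fun t => φ t (y j)) x a a' -
      hessMatrix (fun t => φ t (y j)) θ₀ a a')| ≤ b * n * δ := by
    calc _ ≤ ∑ j ∈ Finset.range n, |hessMatrix (fun t => φ t (y j)) x a a' -
          hessMatrix (fun t => φ t (y j)) θ₀ a a'| := Finset.abs_sum_le_sum_abs _ _
      _ ≤ ∑ j ∈ Finset.range n, B₃ j * ‖x - θ₀‖ := Finset.sum_le_sum fun j _ =>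
          (hφ j).abs_hessMatrix_sub_le hsc (hB₃ j) hθ₀ hx a a'
      _ ≤ b * n * δ := by
          rw [← Finset.sum_mul]
          have h0 : 0 ≤ ∑ j ∈ Finset.range n, B₃ j :=
            Finset.sum_nonneg fun j _ => (norm_nonneg _).trans (hB₃ j x hx)
          exact mul_le_mul hb hxδ (norm_nonneg _) (h0.trans hb)
  -- Moving from `x` to `θ₀` costs bδ by the Lipschitz bound; the sampling error at `θ₀` costs ε.
  have h3 : hessMatrix (empRisk φ y n) x a a' - M a a' =
      (n : ℝ)⁻¹ * (∑ j ∈ Finset.range n, (hessMatrix (fun t => φ t (y j)) x a a' -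
        hessMatrix (fun t => φ t (y j)) θ₀ a a') +
        (∑ j ∈ Finset.range n, hessMatrix (fun t => φ t (y j)) θ₀ a a' - n * M a a')) := by
    rw [h1, Finset.sum_sub_distrib]
    field_simp
    ring
  rw [h3, abs_mul, abs_of_pos (inv_pos.2 hn'), inv_mul_le_iff₀ hn']
  refine (abs_add_le _ _).trans ?_
  nlinarith

end Hessian

/-! ### Logarithmic loss and Takeuchi's criterion -/

section InformationCriterion

variable {p : ℕ} {𝓨 : Type*} {Θ : Set (Param p)} {φ : Param p → 𝓨 → ℝ}
  {g : Param p → 𝓨 → ℝ} {ψ : (𝓨 → ℝ) → 𝓨 → ℝ} {x : Param p} {y : ℕ → 𝓨} {n : ℕ}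

lemma eventuallyEq_neg_log (hx : x ∈ interior Θ)
    (hlog : ∀ θ ∈ Θ, ∀ z, φ θ z = -Real.log (g θ z)) (z : 𝓨) :
    (fun t => φ t z) =ᶠ[𝓝 x] fun t => -Real.log (g t z) := by
  filter_upwards [isOpen_interior.mem_nhds hx] with t ht using hlog t (interior_subset ht) z

lemma gradient_eq_neg_gradient_log (hx : x ∈ interior Θ)
    (hlog : ∀ θ ∈ Θ, ∀ z, φ θ z = -Real.log (g θ z)) (z : 𝓨) :
    gradient (fun t => φ t z) x = -gradient (fun t => Real.log (g t z)) x := by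
  rw [(eventuallyEq_neg_log hx hlog z).gradient_eq, gradient, gradient, fderiv_fun_neg, map_neg]

lemma obsInfo_eq_hessMatrix (hx : x ∈ interior Θ)
    (hlog : ∀ θ ∈ Θ, ∀ z, φ θ z = -Real.log (g θ z)) :
    obsInfo g y n x = hessMatrix (empRisk φ y n) x := by
  have h1 : empRisk φ y n =ᶠ[𝓝 x]
      -fun t => (n : ℝ)⁻¹ * ∑ i ∈ Finset.range n, Real.log (g t (y i)) := by
    filter_upwards [isOpen_interior.mem_nhds hx] with t ht
    simp only [empRisk, Pi.neg_apply, ← mul_neg, ← Finset.sum_neg_distrib]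
    rw [Finset.sum_congr rfl fun i _ => hlog t (interior_subset ht) (y i)]
  have h2 := (h1.iteratedFDeriv ℝ 2).eq_of_nhds
  ext a b
  simp only [hessMatrix, obsInfo, h2, iteratedFDeriv_neg, Matrix.neg_apply, Matrix.of_apply,
    Pi.neg_apply, _root_.neg_apply]

/-- Both gradients are minus the score, so the signs cancel and only the factor from d̂ᵢ survives.
-/
lemma kMatrix_eq_smul_scoreCov (hx : x ∈ interior Θ)
    (hlogφ : ∀ θ ∈ Θ, ∀ z, φ θ z = -Real.log (g θ z))
    (hlogψ : ∀ θ ∈ Θ, ∀ z, ψ (g θ) z = -Real.log (g θ z)) :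
    kMatrix φ g ψ y n x = ((n : ℝ) - 1)⁻¹ • scoreCov g y n x := by
  have h : ∀ i, outer (vHat g ψ y i x) (dHat φ y n i x) = ((n : ℝ) - 1)⁻¹ •
      outer (gradient (fun t => Real.log (g t (y i))) x)
        (gradient (fun t => Real.log (g t (y i))) x) := by
    intro i
    rw [vHat, dHat, outer_smul, gradient_eq_neg_gradient_log hx hlogφ,
      gradient_eq_neg_gradient_log (φ := fun θ => ψ (g θ)) hx hlogψ]
    congr 1
    ext a b
    simp [outer]
  simp_rw [kMatrix, scoreCov, h, ← Finset.smul_sum]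
  exact smul_comm _ _ _

/-- For the logarithmic loss, `UACV` and `TIC / (2n)` differ by a multiple of the trace. -/
lemma uacv_eq_tic (hn : 2 ≤ n) (hx : x ∈ interior Θ)
    (hlogφ : ∀ θ ∈ Θ, ∀ z, φ θ z = -Real.log (g θ z))
    (hlogψ : ∀ θ ∈ Θ, ∀ z, ψ (g θ) z = -Real.log (g θ z)) :
    uacv φ g ψ y n x = tic g y n x / (2 * n) + ((n : ℝ) * (n - 1))⁻¹ *
      Matrix.trace ((obsInfo g y n x)⁻¹ * scoreCov g y n x) := by
  have hn' : (2 : ℝ) ≤ n := by exact_mod_cast hn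
  have h0 : (n : ℝ) ≠ 0 := by positivity
  have h1 : (n : ℝ) - 1 ≠ 0 := by linarith
  rw [uacv, tic, kMatrix_eq_smul_scoreCov hx hlogφ hlogψ, obsInfo_eq_hessMatrix hx hlogφ,
    Matrix.mul_smul, Matrix.trace_smul, smul_eq_mul,
    Finset.sum_congr rfl fun i _ => hlogψ x (interior_subset hx) (y i), Finset.sum_neg_distrib]
  field_simp
  ring

/-- The trace is the average of the quadratic forms ⟨sᵢ, M sᵢ⟩, each at most c‖sᵢ‖². -/
lemma abs_trace_mul_scoreCov_le {M : Matrix (Fin p) (Fin p) ℝ} {c b : ℝ} {G : ℕ → ℝ}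
    (hM : ∀ v, ‖Matrix.toEuclideanLin M v‖ ≤ c * ‖v‖) (hc : 0 ≤ c) (hn : 0 < n)
    (hG : ∀ i, ‖gradient (fun t => Real.log (g t (y i))) x‖ ^ 2 ≤ G i)
    (hb : ∑ i ∈ Finset.range n, G i ≤ b * n) :
    |Matrix.trace (M * scoreCov g y n x)| ≤ c * b := by
  have hn' : (0 : ℝ) < n := by exact_mod_cast hn
  rw [scoreCov, Matrix.mul_smul, Matrix.trace_smul, Matrix.mul_sum, Matrix.trace_sum, smul_eq_mul,
    abs_mul, abs_of_pos (inv_pos.2 hn'), inv_mul_le_iff₀ hn']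
  calc _ ≤ ∑ i ∈ Finset.range n, c * G i := by
        refine (Finset.abs_sum_le_sum_abs _ _).trans (Finset.sum_le_sum fun i _ => ?_)
        rw [trace_mul_outer]
        refine (abs_real_inner_le_norm _ _).trans ?_
        calc _ ≤ ‖gradient (fun t => Real.log (g t (y i))) x‖ *
              (c * ‖gradient (fun t => Real.log (g t (y i))) x‖) := by gcongr; exact hM _
          _ = c * ‖gradient (fun t => Real.log (g t (y i))) x‖ ^ 2 := by ring
          _ ≤ c * G i := by gcongr; exact hG i
    _ ≤ n * (c * b) := by rw [← Finset.mul_sum]; nlinarith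

end InformationCriterion

/-! ### The uniform expansion -/

section Main

variable {p : ℕ} {Ω 𝓨 : Type*} [MeasurableSpace Ω] [MeasurableSpace 𝓨] {P : Measure Ω}
  {Q : Measure 𝓨} {Y : ℕ → Ω → 𝓨} {Θ : Set (Param p)} {φ : Param p → 𝓨 → ℝ} {θ₀ : Param p}

/-- With probability tending to one the estimators lie near `θ₀`, the Hessian is invertible with a
bounded inverse, and the leave-one-out estimators have their expansion, uniformly in the index. -/
lemma exists_whp_expansion [IsProbabilityMeasure P] [IsProbabilityMeasure Q]
    (hY : ∀ i, HasLaw (Y i) Q P) (hi : iIndepFun Y P)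
    (hφ_meas : ∀ θ ∈ Θ, Measurable (φ θ)) (hφ_cont : ∀ y, ContinuousOn (fun θ => φ θ y) Θ)
    (hφ_diff : ∀ y, DiffTimesOn 3 (fun θ => φ θ y) (interior Θ))
    (hφ_int : Integrable (φ θ₀) Q)
    (hmin : ∀ θ ∈ Θ, θ ≠ θ₀ → Integrable (φ θ) Q → ∫ y, φ θ₀ y ∂Q < ∫ y, φ θ y ∂Q)
    (hlower : ∀ θ ∈ Θ, ∃ r : ℝ, 0 < r ∧ ∃ h : 𝓨 → ℝ, Integrable h Q ∧
      ∀ᵐ y ∂Q, ∀ t ∈ Θ ∩ Metric.ball θ r, h y ≤ φ t y)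
    {r : ℝ} (hr : 0 < r) (hrΘ : Metric.ball θ₀ r ⊆ interior Θ) {B₁ B₂ B₃ : 𝓨 → ℝ}
    (hdom : ∀ᵐ y ∂Q, ∀ θ ∈ Metric.ball θ₀ r,
      ‖iteratedFDeriv ℝ 1 (fun t => φ t y) θ‖ ≤ B₁ y ∧
      ‖iteratedFDeriv ℝ 2 (fun t => φ t y) θ‖ ≤ B₂ y ∧
      ‖iteratedFDeriv ℝ 3 (fun t => φ t y) θ‖ ≤ B₃ y)
    (hB₂_int : Integrable B₂ Q) (hB₃_int : Integrable B₃ Q)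
    (hH : (Matrix.of fun a b => ∫ y, hessMatrix (fun t => φ t y) θ₀ a b ∂Q).det ≠ 0)
    {θhat : ℕ → Ω → Param p} {θloo : ℕ → ℕ → Ω → Param p}
    {K₀ : Set (Param p)} (hK₀ : IsCompact K₀) (hK₀Θ : K₀ ⊆ Θ)
    (hest : WHP P fun n ω => (IsArgmin (empRisk φ (fun j => Y j ω) n) Θ (θhat n ω) ∧
          θhat n ω ∈ K₀) ∧
        ∀ i < n, IsArgmin (looRisk φ (fun j => Y j ω) n i) Θ (θloo n i ω) ∧ θloo n i ω ∈ K₀) :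
    ∃ c : ℝ, 0 < c ∧ WHP P fun n ω =>
      θhat n ω ∈ Metric.ball θ₀ r ∧
      (hessMatrix (empRisk φ (fun j => Y j ω) n) (θhat n ω)).det ≠ 0 ∧
      (∀ v, ‖Matrix.toEuclideanLin
        (hessMatrix (empRisk φ (fun j => Y j ω) n) (θhat n ω))⁻¹ v‖ ≤ c * ‖v‖) ∧
      ∀ i < n, θloo n i ω ∈ Metric.ball θ₀ r ∧
        ‖θloo n i ω - θhat n ω‖ ≤ c * (B₁ (Y i ω) / n) ∧
        ‖θloo n i ω - θhat n ω - Matrix.toEuclideanLin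
            (hessMatrix (empRisk φ (fun j => Y j ω) n) (θhat n ω))⁻¹
            (dHat φ (fun j => Y j ω) n i (θhat n ω))‖ ≤
          c * (B₁ (Y i ω) * (1 + B₁ (Y i ω) + B₂ (Y i ω))) * ((n : ℝ) ^ 2)⁻¹ := by
  obtain ⟨ε, hε, c, hc, hinv⟩ := exists_bound_inv hH
  obtain ⟨b, hb, hsum⟩ := exists_whp_sum_le hY hi hB₃_int
  -- The second entry leaves ε/2 of the Hessian tolerance to the law of large numbers; the third
  -- gives the absorption condition 12cb‖Δ‖ ≤ 1, since ‖Δ‖ ≤ 2δ.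
  set δ := min r (min (ε / (2 * b)) (1 / (24 * c * b)))
  have hδ : 0 < δ := by positivity
  have hδr : δ ≤ r := min_le_left _ _
  have hδε : b * δ ≤ ε / 2 := by
    have : δ ≤ ε / (2 * b) := (min_le_right _ _).trans (min_le_left _ _)
    rw [le_div_iff₀ (by positivity)] at this
    linarith
  have hδc : 24 * c * b * δ ≤ 1 := by
    have : δ ≤ 1 / (24 * c * b) := (min_le_right _ _).trans (min_le_right _ _)
    rw [le_div_iff₀ (by positivity)] at this
    linarith
  set s := Metric.ball θ₀ δ
  have hsr : s ⊆ Metric.ball θ₀ r := Metric.ball_subset_ball hδr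
  have hso : IsOpen s := Metric.isOpen_ball
  have hsc : Convex ℝ s := convex_ball θ₀ δ
  have hsΘ : s ⊆ interior Θ := hsr.trans hrΘ
  have hθs : θ₀ ∈ s := Metric.mem_ball_self hδ
  have hcons := whp_not_isArgmin (K := K₀ \ s) hY hi hφ_meas hφ_cont (interior_subset (hsΘ hθs))
    hφ_int hmin hlower (hK₀.diff hso) (Set.sdiff_subset.trans hK₀Θ) (fun h => h.2 hθs)
  have hhess_int : ∀ a a', Integrable (fun y => hessMatrix (fun t => φ t y) θ₀ a a') Q := by
    intro a a'
    refine hB₂_int.mono' (measurable_hessMatrix hφ_meas hφ_diff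
      (hsΘ hθs) a a').aestronglyMeasurable ?_
    filter_upwards [hdom] with y hy
    exact (abs_hessMatrix_le _ _ a a').trans (hy θ₀ (hsr hθs)).2.1
  have hhess := whp_all fun a => whp_all fun a' =>
    whp_sum_sub_le hY hi (hhess_int a a') (half_pos hε)
  -- This is the absorption condition 12cB₂ ≤ n, for all indices simultaneously.
  have hmax := whp_forall_abs_le (P := P) hY hB₂_int (ε := 1 / (12 * c)) (by positivity)
  have hae := whp_of_ae (P := P) (E := fun _ ω => ∀ j, ∀ θ ∈ Metric.ball θ₀ r,
      ‖iteratedFDeriv ℝ 1 (fun t => φ t (Y j ω)) θ‖ ≤ B₁ (Y j ω) ∧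
      ‖iteratedFDeriv ℝ 2 (fun t => φ t (Y j ω)) θ‖ ≤ B₂ (Y j ω) ∧
      ‖iteratedFDeriv ℝ 3 (fun t => φ t (Y j ω)) θ‖ ≤ B₃ (Y j ω)) (by
    filter_upwards [ae_forall_sample hY hdom] with ω hω using fun _ => hω)
  obtain ⟨C, hCdef⟩ : ∃ C, C = 8 * c ^ 3 + 8 * c ^ 2 + 32 * b * c ^ 3 := ⟨_, rfl⟩
  have hC : 0 < C := by rw [hCdef]; positivity
  refine ⟨4 * c + C, by positivity,
    (((hest.and hcons).and (hsum.and hhess)).and (hmax.and hae)).mono_eventually ?_⟩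
  filter_upwards [eventually_ge_atTop 2, eventually_ge_atTop ⌈12 * c ^ 2⌉₊]
    with n hn hnc ω ⟨⟨⟨⟨⟨hxmin, hxK⟩, hzmin⟩, hcs⟩, hS, hhs⟩, hmx, hd⟩
  have hn' : (2 : ℝ) ≤ n := by exact_mod_cast hn
  have hnc' : 12 * c ^ 2 ≤ n := (Nat.le_ceil _).trans (Nat.cast_le.2 hnc)
  have hx : θhat n ω ∈ s := by
    by_contra h
    exact (hcs _ ⟨hxK, h⟩).1 hxmin
  have hz : ∀ i < n, θloo n i ω ∈ s := fun i hi => by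
    by_contra h
    exact (hcs _ ⟨(hzmin i hi).2, h⟩).2 i hi (hzmin i hi).1
  have hφs : ∀ j, DiffTimesOn 3 (fun t => φ t (Y j ω)) s := fun j => (hφ_diff _).mono hsΘ
  obtain ⟨hdet, hMc, hMic⟩ := hinv (hessMatrix (empRisk φ (fun j => Y j ω) n) (θhat n ω))
    fun a a' => (abs_hessMatrix_empRisk_sub_le hso hsc hφs
      (fun j t ht => (hd j t (hsr ht)).2.2) (by omega) hS hx hθs
      (mem_ball_iff_norm.1 hx).le a a' (hhs a a')).trans (by linarith)
  refine ⟨hsr hx, hdet, fun v => (hMic v).trans (by gcongr; linarith), fun i hin => ?_⟩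
  have hB₁0 : 0 ≤ B₁ (Y i ω) := (norm_nonneg _).trans (hd i θ₀ (hsr hθs)).1
  have hB₂0 : 0 ≤ B₂ (Y i ω) := (norm_nonneg _).trans (hd i θ₀ (hsr hθs)).2.1
  have hw := norm_hess_displacement_sub_dHat_le (y := fun j => Y j ω) hso hsc hsΘ hφs
    (fun j t ht => (hd j t (hsr ht)).2.1) (fun j t ht => (hd j t (hsr ht)).2.2) hn hin hx
    (hz i hin) hxmin (hzmin i hin).1 hMc hS
  have hdist : ‖θloo n i ω - θhat n ω‖ ≤ 2 * δ := by
    rw [← dist_eq_norm]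
    have := dist_triangle_right (θloo n i ω) (θhat n ω) θ₀
    linarith [Metric.mem_ball.1 hx, Metric.mem_ball.1 (hz i hin)]
  have hB₂n : 12 * c * B₂ (Y i ω) ≤ n := by
    have h1 := (le_abs_self _).trans (hmx i hin)
    rw [one_div, inv_mul_eq_div, le_div_iff₀ (by positivity)] at h1
    linarith
  have h3 : 12 * c * b * ‖θloo n i ω - θhat n ω‖ ≤ 1 := by
    calc 12 * c * b * ‖θloo n i ω - θhat n ω‖ ≤ 12 * c * b * (2 * δ) := by gcongr
      _ ≤ 1 := by linarith
  obtain ⟨h4, h5⟩ := displacement_bounds hc hb hB₁0 hB₂0 hn' hdet hMic hw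
    (norm_dHat_le hn (hd i _ (hsr hx)).1) hnc' hB₂n h3
  rw [← hCdef] at h5
  exact ⟨hsr (hz i hin), h4.trans (by gcongr; linarith), h5.trans (by gcongr; linarith)⟩

end Main

end CrossVal

/-! ### The theorem -/

theorem mainTheorem1 {p : ℕ} {𝓨 Ω : Type*} [MeasurableSpace 𝓨] [MeasurableSpace Ω]
    -- the i.i.d. sample `Y 0, Y 1, …` with law `Q`
    (P : Measure Ω) [IsProbabilityMeasure P] (Q : Measure 𝓨) (Y : ℕ → Ω → 𝓨)
    (hY_law : ∀ i, HasLaw (Y i) Q P) (hY_indep : iIndepFun Y P)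
    -- the family `g^θ`, the estimating loss `φ` and the assessment loss `ψ`
    (Θ : Set (CrossVal.Param p)) (g : CrossVal.Param p → 𝓨 → ℝ)
    (φ : CrossVal.Param p → 𝓨 → ℝ) (ψ : (𝓨 → ℝ) → 𝓨 → ℝ)
    (hφ_meas : ∀ θ ∈ Θ, Measurable (φ θ))
    (hφ_cont : ∀ y, ContinuousOn (fun θ => φ θ y) Θ)
    (hφ_diff : ∀ y, CrossVal.DiffTimesOn 3 (fun θ => φ θ y) (interior Θ))
    (hψ_diff : ∀ y, CrossVal.DiffTimesOn 2 (fun θ => ψ (g θ) y) (interior Θ))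
    -- `θ₀` is an interior point and the only minimiser of `Φ_∞(θ) = E φ(θ, Y)` over `Θ`;
    -- by the next hypothesis `Φ_∞(θ)` is `+∞` where `φ θ` is not integrable
    (θ₀ : CrossVal.Param p) (hθ₀ : θ₀ ∈ interior Θ) (hφ_int : Integrable (φ θ₀) Q)
    (hmin : ∀ θ ∈ Θ, θ ≠ θ₀ → Integrable (φ θ) Q → ∫ y, φ θ₀ y ∂Q < ∫ y, φ θ y ∂Q)
    -- `φ` has an integrable lower bound near each parameter
    (hlower : ∀ θ ∈ Θ, ∃ r : ℝ, 0 < r ∧ ∃ h : 𝓨 → ℝ, Integrable h Q ∧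
      ∀ᵐ y ∂Q, ∀ t ∈ Θ ∩ Metric.ball θ r, h y ≤ φ t y)
    -- near `θ₀` the derivatives are dominated by functions with finite moments
    (r : ℝ) (hr : 0 < r) (B₁ B₂ B₃ C₁ C₂ : 𝓨 → ℝ)
    (hB₁ : Measurable B₁) (hB₂ : Measurable B₂) (hB₃ : Measurable B₃)
    (hC₁ : Measurable C₁) (hC₂ : Measurable C₂)
    (hφ_dom : ∀ᵐ y ∂Q, ∀ θ ∈ interior Θ ∩ Metric.ball θ₀ r,
      ‖iteratedFDeriv ℝ 1 (fun t => φ t y) θ‖ ≤ B₁ y ∧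
      ‖iteratedFDeriv ℝ 2 (fun t => φ t y) θ‖ ≤ B₂ y ∧
      ‖iteratedFDeriv ℝ 3 (fun t => φ t y) θ‖ ≤ B₃ y)
    (hψ_dom : ∀ᵐ y ∂Q, ∀ θ ∈ interior Θ ∩ Metric.ball θ₀ r,
      ‖iteratedFDeriv ℝ 1 (fun t => ψ (g t) y) θ‖ ≤ C₁ y ∧
      ‖iteratedFDeriv ℝ 2 (fun t => ψ (g t) y) θ‖ ≤ C₂ y)
    (hB₂_int : Integrable B₂ Q) (hB₃_int : Integrable B₃ Q)
    (hC₁_int : Integrable (fun y => C₁ y * B₁ y * (1 + B₁ y + B₂ y)) Q)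
    (hC₂_int : Integrable (fun y => C₂ y * B₁ y ^ 2) Q)
    -- the expected Hessian at `θ₀` is nonsingular
    (hH : (Matrix.of fun a b =>
      ∫ y, CrossVal.hessMatrix (fun t => φ t y) θ₀ a b ∂Q).det ≠ 0)
    -- the estimators: `θhat n` is `θ̂` and `θloo n i` is `θ̂₋ᵢ`; with probability tending to one
    -- they are minimisers over `Θ` and lie in a fixed compact subset of `Θ`
    (θhat : ℕ → Ω → CrossVal.Param p) (θloo : ℕ → ℕ → Ω → CrossVal.Param p)
    (K₀ : Set (CrossVal.Param p)) (hK₀ : IsCompact K₀) (hK₀Θ : K₀ ⊆ Θ)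
    (hest : Tendsto (fun n : ℕ => P {ω | ¬ (
        (CrossVal.IsArgmin (CrossVal.empRisk φ (fun j => Y j ω) n) Θ (θhat n ω) ∧
          θhat n ω ∈ K₀) ∧
        ∀ i < n, CrossVal.IsArgmin (CrossVal.looRisk φ (fun j => Y j ω) n i) Θ (θloo n i ω) ∧
          θloo n i ω ∈ K₀)}) atTop (𝓝 0)) :
    -- with probability tending to one, the derivatives and the inverse used below exist
    Tendsto (fun n : ℕ => P {ω | ¬ (θhat n ω ∈ interior Θ ∧
        (CrossVal.hessMatrix (CrossVal.empRisk φ (fun j => Y j ω) n) (θhat n ω)).det ≠ 0)})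
      atTop (𝓝 0) ∧
    -- `θ̂₋ᵢ - θ̂ = H⁻¹ d̂ᵢ + O_p(n⁻²)`, for every choice of indices `i = i n < n`
    (∀ i : ℕ → ℕ, (∀ n, 0 < n → i n < n) →
      CrossVal.IsBigOp P (fun n ω => θloo n (i n) ω - θhat n ω -
          Matrix.toEuclideanLin
            (CrossVal.hessMatrix (CrossVal.empRisk φ (fun j => Y j ω) n) (θhat n ω))⁻¹
            (CrossVal.dHat φ (fun j => Y j ω) n (i n) (θhat n ω)))
        (fun n => ((n : ℝ) ^ 2)⁻¹)) ∧
    -- `CV = UACV + O_p(n⁻²)`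
    CrossVal.IsBigOp P (fun n ω =>
        CrossVal.cvCrit g ψ (fun j => Y j ω) n (fun i => θloo n i ω) -
          CrossVal.uacv φ g ψ (fun j => Y j ω) n (θhat n ω))
      (fun n => ((n : ℝ) ^ 2)⁻¹) ∧
    -- if both losses are `-log g^θ`, then `UACV` is `TIC / (2n)`, up to the replacement of
    -- `1/(n-1)` by `1/n` in the correction term, which costs `O_p(n⁻²)`
    ((∀ θ ∈ Θ, ∀ y, 0 < g θ y ∧ φ θ y = -Real.log (g θ y) ∧ ψ (g θ) y = -Real.log (g θ y)) →
      (∀ n : ℕ, 2 ≤ n → ∀ ω, θhat n ω ∈ interior Θ →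
        CrossVal.uacv φ g ψ (fun j => Y j ω) n (θhat n ω) =
          CrossVal.tic g (fun j => Y j ω) n (θhat n ω) / (2 * n) +
            ((n : ℝ) * (n - 1))⁻¹ * Matrix.trace
              ((CrossVal.obsInfo g (fun j => Y j ω) n (θhat n ω))⁻¹ *
                CrossVal.scoreCov g (fun j => Y j ω) n (θhat n ω))) ∧
      CrossVal.IsBigOp P (fun n ω =>
          CrossVal.uacv φ g ψ (fun j => Y j ω) n (θhat n ω) -
            CrossVal.tic g (fun j => Y j ω) n (θhat n ω) / (2 * n))
        (fun n => ((n : ℝ) ^ 2)⁻¹)) := by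
  have hQ : IsProbabilityMeasure Q := (hY_law 0).isProbabilityMeasure_iff.1 inferInstance
  obtain ⟨r₁, hr₁, hr₁Θ⟩ := Metric.isOpen_iff.1 isOpen_interior θ₀ hθ₀
  -- The given ball may leave Θ; the smaller one is convex and interior, as the Taylor bounds need.
  obtain ⟨ρ, hρ, hρr, hρΘ⟩ : ∃ ρ > 0, Metric.ball θ₀ ρ ⊆ Metric.ball θ₀ r ∧
      Metric.ball θ₀ ρ ⊆ interior Θ :=
    ⟨min r r₁, lt_min hr hr₁, Metric.ball_subset_ball (min_le_left _ _),
      (Metric.ball_subset_ball (min_le_right _ _)).trans hr₁Θ⟩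
  have hdomφ : ∀ᵐ y ∂Q, ∀ θ ∈ Metric.ball θ₀ ρ,
      ‖iteratedFDeriv ℝ 1 (fun t => φ t y) θ‖ ≤ B₁ y ∧
      ‖iteratedFDeriv ℝ 2 (fun t => φ t y) θ‖ ≤ B₂ y ∧
      ‖iteratedFDeriv ℝ 3 (fun t => φ t y) θ‖ ≤ B₃ y := by
    filter_upwards [hφ_dom] with y hy θ hθ using hy θ ⟨hρΘ hθ, hρr hθ⟩
  have hdomψ : ∀ᵐ y ∂Q, ∀ θ ∈ Metric.ball θ₀ ρ,
      ‖iteratedFDeriv ℝ 1 (fun t => ψ (g t) y) θ‖ ≤ C₁ y ∧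
      ‖iteratedFDeriv ℝ 2 (fun t => ψ (g t) y) θ‖ ≤ C₂ y := by
    filter_upwards [hψ_dom] with y hy θ hθ using hy θ ⟨hρΘ hθ, hρr hθ⟩
  obtain ⟨c, hc, hmain⟩ := CrossVal.exists_whp_expansion hY_law hY_indep hφ_meas hφ_cont hφ_diff
    hφ_int hmin hlower hρ hρΘ hdomφ hB₂_int hB₃_int hH hK₀ hK₀Θ hest
  have hae := CrossVal.whp_of_ae (P := P) (E := fun _ ω => ∀ j, ∀ θ ∈ Metric.ball θ₀ ρ,
      (‖iteratedFDeriv ℝ 1 (fun t => φ t (Y j ω)) θ‖ ≤ B₁ (Y j ω) ∧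
      ‖iteratedFDeriv ℝ 2 (fun t => φ t (Y j ω)) θ‖ ≤ B₂ (Y j ω) ∧
      ‖iteratedFDeriv ℝ 3 (fun t => φ t (Y j ω)) θ‖ ≤ B₃ (Y j ω)) ∧
      ‖iteratedFDeriv ℝ 1 (fun t => ψ (g t) (Y j ω)) θ‖ ≤ C₁ (Y j ω) ∧
      ‖iteratedFDeriv ℝ 2 (fun t => ψ (g t) (Y j ω)) θ‖ ≤ C₂ (Y j ω)) (by
    filter_upwards [CrossVal.ae_forall_sample hY_law hdomφ,
      CrossVal.ae_forall_sample hY_law hdomψ] with ω h1 h2 _ j θ hθ using ⟨h1 j θ hθ, h2 j θ hθ⟩)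
  refine ⟨hmain.mono fun n ω h => ⟨hρΘ h.1, h.2.1⟩, fun i hi => ?_, ?_, fun hlog => ⟨?_, ?_⟩⟩
  · refine CrossVal.isBigOp_of_whp_sample (Q := Q) (i := i) hY_law (fun n => by positivity) hc.le
      (f := fun y => B₁ y * (1 + B₁ y + B₂ y))
      (hB₁.mul ((measurable_const.add hB₁).add hB₂)) (hmain.mono_eventually ?_)
    filter_upwards [eventually_gt_atTop 0] with n hn ω h
    exact (h.2.2.2 (i n) (hi n hn)).2.2
  · obtain ⟨b, -, hsum⟩ := CrossVal.exists_whp_sum_le hY_law hY_indep (hC₂_int.add hC₁_int)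
    refine CrossVal.isBigOp_of_whp (C := (c ^ 2 + c) * b)
      (((hmain.and hae).and hsum).mono_eventually ?_)
    filter_upwards [eventually_gt_atTop 0] with n hn ω ⟨⟨⟨hx, _, _, hloo⟩, hd⟩, hS⟩
    have hn' : (0 : ℝ) < n := by exact_mod_cast hn
    rw [CrossVal.cvCrit_sub_uacv (CrossVal.hessMatrix_empRisk_transpose fun j =>
      (hφ_diff _).contDiffAt isOpen_interior (hρΘ hx)), Real.norm_eq_abs, abs_mul,
      abs_of_pos (inv_pos.2 hn'), inv_mul_le_iff₀ hn']
    refine (Finset.abs_sum_le_sum_abs _ _).trans ((Finset.sum_le_sum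
      (g := fun i => (c ^ 2 + c) * ((n : ℝ) ^ 2)⁻¹ * ((fun y => C₂ y * B₁ y ^ 2) +
        fun y => C₁ y * B₁ y * (1 + B₁ y + B₂ y)) (Y i ω)) fun i hin => ?_).trans ?_)
    · obtain ⟨hz, h1, h2⟩ := hloo i (Finset.mem_range.1 hin)
      refine (CrossVal.abs_cv_term_le ((hψ_diff (Y i ω)).mono hρΘ) (convex_ball θ₀ ρ)
        (fun t ht => (hd i t ht).2.1) (fun t ht => (hd i t ht).2.2) hx hz h1 h2).trans ?_
      have hθ := hd i θ₀ (Metric.mem_ball_self hρ)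
      have hB₁0 := (norm_nonneg _).trans hθ.1.1
      have hB₂0 := (norm_nonneg _).trans hθ.1.2.1
      have hC₁0 := (norm_nonneg _).trans hθ.2.1
      have hC₂0 := (norm_nonneg _).trans hθ.2.2
      -- The term bound needs c² for the C₂ part and c for the C₁ part; the cross terms left over
      -- are nonnegative.
      have e : (c ^ 2 + c) * ((n : ℝ) ^ 2)⁻¹ *
          ((fun y => C₂ y * B₁ y ^ 2) + fun y => C₁ y * B₁ y * (1 + B₁ y + B₂ y)) (Y i ω) =
          (C₂ (Y i ω) * (c * (B₁ (Y i ω) / n)) ^ 2 +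
            C₁ (Y i ω) * (c * (B₁ (Y i ω) * (1 + B₁ (Y i ω) + B₂ (Y i ω))) * ((n : ℝ) ^ 2)⁻¹)) +
          (c * ((n : ℝ) ^ 2)⁻¹ * (C₂ (Y i ω) * B₁ (Y i ω) ^ 2) +
            c ^ 2 * ((n : ℝ) ^ 2)⁻¹ *
              (C₁ (Y i ω) * B₁ (Y i ω) * (1 + B₁ (Y i ω) + B₂ (Y i ω)))) := by
        simp only [Pi.add_apply]
        field_simp
        ring
      rw [e]
      exact le_add_of_nonneg_right (by positivity)
    · rw [← Finset.mul_sum]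
      calc _ ≤ (c ^ 2 + c) * ((n : ℝ) ^ 2)⁻¹ * (b * n) := by gcongr
        _ = _ := by ring
  · intro n hn ω hx
    exact CrossVal.uacv_eq_tic hn hx (fun θ hθ y => (hlog θ hθ y).2.1)
      fun θ hθ y => (hlog θ hθ y).2.2
  · obtain ⟨b, hb, hsum⟩ := CrossVal.exists_whp_sum_le hY_law hY_indep hC₁_int
    refine CrossVal.isBigOp_of_whp (C := 2 * (c * b))
      (((hmain.and hae).and hsum).mono_eventually ?_)
    filter_upwards [eventually_ge_atTop 2] with n hn ω ⟨⟨⟨hx, _, hinv, _⟩, hd⟩, hS⟩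
    have hn' : (2 : ℝ) ≤ n := by exact_mod_cast hn
    have hlogφ : ∀ θ ∈ Θ, ∀ y, φ θ y = -Real.log (g θ y) := fun θ hθ y => (hlog θ hθ y).2.1
    have hlogψ : ∀ θ ∈ Θ, ∀ y, ψ (g θ) y = -Real.log (g θ y) := fun θ hθ y => (hlog θ hθ y).2.2
    -- The score is minus the gradient of both losses, so one factor is bounded by B₁ and the other
    -- by C₁, whose product is controlled by `hC₁_int`.
    have hG : ∀ i, ‖gradient (fun t => Real.log (g t (Y i ω))) (θhat n ω)‖ ^ 2 ≤
        C₁ (Y i ω) * B₁ (Y i ω) * (1 + B₁ (Y i ω) + B₂ (Y i ω)) := by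
      intro i
      have hxd := hd i _ hx
      have hB₁0 := (norm_nonneg _).trans hxd.1.1
      have hB₂0 := (norm_nonneg _).trans hxd.1.2.1
      have hC₁0 := (norm_nonneg _).trans hxd.2.1
      have h1 : ‖gradient (fun t => Real.log (g t (Y i ω))) (θhat n ω)‖ ≤ B₁ (Y i ω) := by
        rw [← norm_neg, ← CrossVal.gradient_eq_neg_gradient_log (hρΘ hx) hlogφ,
          CrossVal.norm_gradient_eq]
        exact hxd.1.1
      have h2 : ‖gradient (fun t => Real.log (g t (Y i ω))) (θhat n ω)‖ ≤ C₁ (Y i ω) := by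
        rw [← norm_neg, ← CrossVal.gradient_eq_neg_gradient_log (φ := fun θ => ψ (g θ))
          (hρΘ hx) hlogψ, CrossVal.norm_gradient_eq]
        exact hxd.2.1
      calc _ = ‖gradient (fun t => Real.log (g t (Y i ω))) (θhat n ω)‖ *
            ‖gradient (fun t => Real.log (g t (Y i ω))) (θhat n ω)‖ := pow_two _
        _ ≤ C₁ (Y i ω) * B₁ (Y i ω) := mul_le_mul h2 h1 (norm_nonneg _) hC₁0
        _ ≤ C₁ (Y i ω) * B₁ (Y i ω) * (1 + B₁ (Y i ω) + B₂ (Y i ω)) :=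
          le_mul_of_one_le_right (by positivity) (by linarith)
    have htr := CrossVal.abs_trace_mul_scoreCov_le (g := g) (y := fun j => Y j ω)
      (x := θhat n ω) hinv hc.le (by omega : 0 < n) hG hS
    rw [CrossVal.uacv_eq_tic hn (hρΘ hx) hlogφ hlogψ, add_sub_cancel_left, Real.norm_eq_abs,
      abs_mul, CrossVal.obsInfo_eq_hessMatrix (hρΘ hx) hlogφ]
    have h1 : (0 : ℝ) < n * (n - 1) := mul_pos (by linarith) (by linarith)
    -- Equivalent to n ≤ 2(n - 1), which is where n ≥ 2 enters.
    have h2 : ((n : ℝ) * (n - 1))⁻¹ ≤ 2 * ((n : ℝ) ^ 2)⁻¹ := by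
      rw [← div_eq_mul_inv, inv_eq_one_div, div_le_div_iff₀ h1 (by positivity)]
      nlinarith
    rw [abs_of_pos (inv_pos.2 h1)]
    calc _ ≤ 2 * ((n : ℝ) ^ 2)⁻¹ * (c * b) := by gcongr
      _ = _ := by ring
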